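/- For a compact set $E\subset\mathbb R$ that is a finite union of nondegenerate intervals, let $g_E$ be the Green function of $\overline{\mathbb C}\setminus E$ with pole at $\infty$, extended by $0$ to $E$: the unique continuous function on $\mathbb C$ that vanishes on $E$, is harmonic on $\mathbb C\setminus E$, and satisfies $g_E(z)=\log|z|+O(1)$ as $z\to\infty$. For $0<\delta<1$ and $\delta-1<\alpha\le 0$ put $$E(\alpha,\delta)=[-1,1]\setminus(\alpha-\delta,\alpha+\delta),\qquad E(\delta)=[-1+2\delta,1],$$ and for real $x$ let $G_{\alpha,\delta}(x)=g_{E(\alpha,\delta)}(x)$, $G_\delta(x)=g_{E(\delta)}(x)$ and $$\Phi_\delta(x)=\sup_{\alpha\in(\delta-1,0]}G_{\alpha,\delta}(x).$$ The equation $\delta_*^2=\dfrac{1-\delta_*}{1+\delta_*}$ has a unique solution $\delta_*\in(0,1)$, and $\delta_*=0.543689\ldots$. (i) If $0<\delta<\delta_*$, then $\Phi_\delta$ does not coincide identically with $G_\delta$ on $(-1,0]$; that is, there is $x\in(-1,0]$ with $\Phi_\delta(x)\ne G_\delta(x)$. (ii) For every $\delta\in(0,1)$ there is $x_*(\delta)>-1$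 such that $\Phi_\delta(x)=G_\delta(x)$ for all $x\in(-1,x_*(\delta))$; moreover $\Phi_\delta(x)\to G_\delta(-1)$ as $x\downarrow-1$, so that the two functions coincide on $[-1,x_*(\delta))$ when $\Phi_\delta(-1)$ is understood as the limit value $\lim_{x\downarrow-1}\Phi_\delta(x)$. -/

import Mathlib

open Set Filter Topology

/-- `g` is the Green function, with pole at infinity, of the complement of the compact set `E` in
the Riemann sphere, restricted to the finite plane and extended by zero to `E`: it is harmonic off
`E`, it is `log |z| + O(1)` at infinity, and it has boundary values zero at every point of `E`
(expressed by continuity on the plane together with vanishing on `E`). -/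
structure IsGreenInfty (E : Set ℂ) (g : ℂ → ℝ) : Prop where
  harmonic : InnerProductSpace.HarmonicOnNhd g Eᶜ
  continuous : Continuous g
  eq_zero : ∀ z ∈ E, g z = 0
  log_pole : Asymptotics.IsBigO (cocompact ℂ) (fun z => g z - Real.log ‖z‖) (fun _ => (1 : ℝ))

open Classical in
/-- The Green function with pole at infinity of the complement of `E`, extended by zero to `E`.
It is uniquely determined by `IsGreenInfty` as soon as it exists. It exists when `E` is a
nonempty finite union of nondegenerate compact real intervals. The value `0` is a placeholder
for sets without such a function. -/
noncomputable def greenInfty (E : Set ℂ) : ℂ → ℝ :=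
  if h : ∃ g, IsGreenInfty E g then h.choose else 0

/-- The set `E(α, δ) = [-1, 1] \ (α - δ, α + δ)`, as a subset of the complex plane. -/
def twoIntervals (α δ : ℝ) : Set ℂ :=
  (fun t : ℝ => (t : ℂ)) '' (Icc (-1) 1 \ Ioo (α - δ) (α + δ))

/-- The interval `E(δ) = [-1 + 2δ, 1]`, as a subset of the complex plane. -/
def oneInterval (δ : ℝ) : Set ℂ :=
  (fun t : ℝ => (t : ℂ)) '' Icc (-1 + 2 * δ) 1

/-- The restriction to the real line of the Green function of the complement of `E(α, δ)`. -/
noncomputable def greenTwo (α δ x : ℝ) : ℝ := greenInfty (twoIntervals α δ) (x : ℂ)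

/-- The restriction to the real line of the Green function of the complement of `E(δ)`. -/
noncomputable def greenOne (δ x : ℝ) : ℝ := greenInfty (oneInterval δ) (x : ℂ)

/-- The upper envelope: the supremum of the Green functions of the complements of `E(α, δ)` over
`α ∈ (δ - 1, 0]`, taken in the extended reals. -/
noncomputable def upperEnvelope (δ x : ℝ) : EReal :=
  ⨆ α ∈ Ioc (δ - 1) 0, (greenTwo α δ x : EReal)

/-! The Green function of one interval `[a, b]` is explicit: it is `arcosh ((|z - a| + |z - b|) / (b
- a))`.

Part (i) is decided at `x = 0` by the single competitor `α = 0`. The map `z ↦ z ^ 2` carries `E(0,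
δ)` onto `[δ ^ 2, 1]`, so `G_{0,δ}(0)` is half an explicit `arcosh`. By the doubling formula for
`arcosh`, it exceeds `G_δ(0)` as soon as `δ ^ 2 (1 + δ) < 1 - δ`, which means `δ < δ_*`.

For part (ii) write `α = δ - 1 + ε`, so that `E(α, δ)` is the union of a short interval `J = [-1, -1
+ ε]` and a long interval `I = [-1 + 2δ + ε, 1]`. By the maximum principle, its Green function lies
between combinations `(1 - κ) g_I + κ (g_J - A)`, with `κ` and `A` chosen so that the combination
has the right sign on `I` and on `J` (`IsGreenInfty.le_combination`, `IsGreenInfty.combination_le`).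
Here `κ` has order `1 / log (1/ε)`. For `x` in the gap and close to `-1`, moving the long interval
by `ε` gains only `O(ε)`, while the short interval costs at least `κ log 2`. The cost wins for small
`ε`, and `ε < x + 1`, so no competitor exceeds `G_δ(x)` (`greenTwo_le_greenOne_add`). For fixed `x`
and `ε → 0` the lower bound tends to `G_δ(x)` (`le_greenTwo`), so the supremum is exactly `G_δ(x)`.

The argument needs a Green function for two disjoint intervals. It is built in
`exists_isGreenInfty_two` as the real part of a primitive of `(z - c) / √((z - p)(z - q)(z - r)(z -
s))` on the upper half plane, reflected across the real axis. The zero `c` is chosen so that the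
boundary values on the two intervals agree. -/

open InnerProductSpace MeasureTheory

/-! ### Harmonic functions and the maximum principle -/

theorem InnerProductSpace.HarmonicAt.comp_analyticAt {f : ℂ → ℝ} {φ : ℂ → ℂ} {z : ℂ}
    (hf : HarmonicAt f (φ z))
    (hφ : AnalyticAt ℂ φ z) : HarmonicAt (fun w => f (φ w)) z := by
  obtain ⟨r, hr, hball⟩ := Metric.isOpen_iff.1 (isOpen_setOfPred_harmonicAt f) (φ z) hf
  obtain ⟨F, hF, hFf⟩ :=
    HarmonicOnNhd.exists_analyticOnNhd_ball_re_eq (f := f) (fun y hy => hball hy)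
  have h1 : AnalyticAt ℂ (fun w => F (φ w)) z :=
    (hF (φ z) (Metric.mem_ball_self hr)).fun_comp hφ
  refine (harmonicAt_congr_nhds ?_).1 h1.harmonicAt_re
  filter_upwards [hφ.continuousAt.preimage_mem_nhds (Metric.ball_mem_nhds _ hr)] with w hw
  exact hFf hw

theorem InnerProductSpace.HarmonicAt.abs_of_ne_zero {f : ℂ → ℝ} {z : ℂ} (hf : HarmonicAt f z)
    (h0 : f z ≠ 0) :
    HarmonicAt (fun w => |f w|) z := by
  have hc : ContinuousAt f z := hf.1.continuousAt
  rcases lt_or_gt_of_ne h0 with h | h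
  · refine (harmonicAt_congr_nhds ?_).1 hf.neg
    filter_upwards [hc.eventually (gt_mem_nhds h)] with w hw
    simp [abs_of_neg hw]
  · refine (harmonicAt_congr_nhds ?_).1 hf
    filter_upwards [hc.eventually (lt_mem_nhds h)] with w hw
    simp [abs_of_pos hw]

/-- If `f = Re F` locally with `F` analytic, then `|exp F| = exp f`, and the maximum modulus
principle applies to `exp F`. -/
theorem InnerProductSpace.HarmonicAt.eventually_eq_of_isLocalMax {f : ℂ → ℝ} {z : ℂ}
    (hf : HarmonicAt f z)
    (hmax : IsLocalMax f z) : ∀ᶠ w in 𝓝 z, f w = f z := by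
  obtain ⟨r, hr, hball⟩ := Metric.isOpen_iff.1 (isOpen_setOfPred_harmonicAt f) z hf
  obtain ⟨F, hF, hFf⟩ :=
    HarmonicOnNhd.exists_analyticOnNhd_ball_re_eq (f := f) (fun y hy => hball hy)
  have hb := Metric.ball_mem_nhds z hr
  have key : ∀ w ∈ Metric.ball z r, ‖Complex.exp (F w)‖ = Real.exp (f w) := fun w hw => by
    rw [Complex.norm_exp]; exact congrArg _ (hFf hw)
  have h1 : ∀ᶠ w in 𝓝 z, ‖Complex.exp (F w)‖ = ‖Complex.exp (F z)‖ := by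
    refine Complex.norm_eventually_eq_of_isLocalMax (f := fun w => Complex.exp (F w)) ?_ ?_
    · filter_upwards [hb] with w hw
      exact (hF w hw).differentiableAt.cexp
    · filter_upwards [hb, hmax] with w hw hle
      simp only [Function.comp]
      rw [key w hw, key z (Metric.mem_ball_self hr)]
      exact Real.exp_le_exp.2 hle
  filter_upwards [hb, h1] with w hw h
  rw [key w hw, key z (Metric.mem_ball_self hr)] at h
  exact Real.exp_injective h

/-- Maximum principle on the complement of a closed set, for functions tending to `-∞`. -/
theorem nonpos_of_harmonicOnNhd_of_tendsto_atBot {E : Set ℂ} {v : ℂ → ℝ}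
    (hharm : HarmonicOnNhd v Eᶜ) (hcont : Continuous v) (hE : ∀ z ∈ E, v z ≤ 0)
    (hinf : Tendsto v (cocompact ℂ) atBot) (z : ℂ) : v z ≤ 0 := by
  obtain ⟨m, hm⟩ := hcont.exists_forall_ge hinf
  refine (hm z).trans ?_
  by_contra! hpos
  -- A positive maximum can only be attained off `E`, so the set where it is attained is open as
  -- well as closed, hence the whole plane. This contradicts the decay at infinity.
  have hclopen : IsClopen {w | v w = v m} := by
    refine ⟨isClosed_eq hcont continuous_const, isOpen_iff_mem_nhds.2 fun w hw => ?_⟩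
    have hwE : w ∈ Eᶜ := fun h => absurd (hE w h) (by rw [mem_ofPred_eq] at hw; linarith)
    have := (hharm w hwE).eventually_eq_of_isLocalMax
      (Eventually.of_forall fun y => (hm y).trans_eq hw.symm)
    filter_upwards [this] with y hy
    exact hy.trans hw
  have huniv := hclopen.eq_univ ⟨m, rfl⟩
  obtain ⟨y, hy⟩ := (hinf.eventually (eventually_lt_atBot (v m))).exists
  have : y ∈ {w | v w = v m} := huniv ▸ mem_univ y
  exact absurd this hy.ne

/-! ### The Green function of one interval -/

/-- The Green function with pole at infinity of the complement of the real interval `[a, b]`. -/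
noncomputable def intervalGreen (a b : ℝ) (z : ℂ) : ℝ :=
  Real.arcosh ((‖z - a‖ + ‖z - b‖) / (b - a))

theorem one_le_intervalGreen_arg {a b : ℝ} (hab : a < b) (z : ℂ) :
    1 ≤ (‖z - a‖ + ‖z - b‖) / (b - a) := by
  rw [one_le_div (sub_pos.2 hab)]
  have h := norm_sub_le (z - a) (z - b)
  have h2 : (z - a) - (z - b) = ((b - a : ℝ) : ℂ) := by push_cast; ring
  rw [h2, Complex.norm_real, Real.norm_of_nonneg (sub_pos.2 hab).le] at h
  exact h

theorem intervalGreen_nonneg {a b : ℝ} (hab : a < b) (z : ℂ) : 0 ≤ intervalGreen a b z :=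
  Real.arcosh_nonneg (one_le_intervalGreen_arg hab z)

theorem continuous_intervalGreen {a b : ℝ} (hab : a < b) : Continuous (intervalGreen a b) := by
  refine Real.continuousOn_arcosh.comp_continuous ?_ (one_le_intervalGreen_arg hab)
  fun_prop

theorem intervalGreen_of_mem {a b t : ℝ} (hab : a < b) (ht : t ∈ Icc a b) :
    intervalGreen a b t = 0 := by
  rw [intervalGreen, ← Complex.ofReal_sub, ← Complex.ofReal_sub, Complex.norm_real,
    Complex.norm_real, Real.norm_of_nonneg (by linarith [ht.1]),
    Real.norm_of_nonpos (by linarith [ht.2])]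
  rw [show (t - a + -(t - b)) / (b - a) = 1 by field_simp [(sub_pos.2 hab).ne']; ring]
  simp

theorem mem_of_norm_add_norm_le {a b : ℝ} {z : ℂ}
    (h : ‖z - a‖ + ‖z - b‖ ≤ b - a) : z ∈ (fun t : ℝ => (t : ℂ)) '' Icc a b := by
  have h1 : (z - a).re ≤ ‖z - a‖ := Complex.re_le_norm _
  have h2 : -(z - b).re ≤ ‖z - b‖ := (neg_le_abs _).trans (Complex.abs_re_le_norm _)
  have h3 := norm_nonneg (z - a)
  have h4 := norm_nonneg (z - b)
  simp only [Complex.sub_re, Complex.ofReal_re] at h1 h2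
  have h5 : ‖z - a‖ = z.re - a := by linarith
  have h6 : z.im = 0 := by
    have := Complex.sq_norm (z - a)
    rw [h5, Complex.normSq_apply] at this
    simp at this
    nlinarith
  exact ⟨z.re, ⟨by linarith, by linarith⟩, Complex.ext (by simp) (by simp [h6])⟩

theorem sub_div_sub_mem_slitPlane {a b : ℝ} (hab : a < b) {z : ℂ}
    (hz : z ∉ (fun t : ℝ => (t : ℂ)) '' Icc a b) : (z - b) / (z - a) ∈ Complex.slitPlane := by
  have hza : z - a ≠ 0 := fun h => hz ⟨a, ⟨le_rfl, hab.le⟩, (sub_eq_zero.1 h).symm⟩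
  by_contra hns
  rw [Complex.mem_slitPlane_iff_not_le_zero, not_not, Complex.le_def] at hns
  obtain ⟨hre, him⟩ := hns
  set q := (z - b) / (z - a) with hq
  have hqr : q = (q.re : ℂ) := Complex.ext (by simp) (by simpa using him)
  have hre' : q.re ≤ 0 := by simpa using hre
  have h1 : z - b = (q.re : ℂ) * (z - a) := by
    rw [← hqr, hq]; field_simp
  apply hz
  refine ⟨(b - q.re * a) / (1 - q.re), ⟨?_, ?_⟩, ?_⟩
  · rw [le_div_iff₀ (by linarith)]; nlinarith
  · rw [div_le_iff₀ (by linarith)]; nlinarith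
  · have h2 : (1 - q.re : ℂ) ≠ 0 := by
      have : (1 - q.re : ℝ) ≠ 0 := by linarith
      exact_mod_cast this
    push_cast
    rw [div_eq_iff h2]
    linear_combination -h1

/-- This is the Joukowski relation `J + 1/J = 2w`: circles `|J| = const` correspond to ellipses with
foci `±1`. -/
theorem cosh_log_norm_of_sq {w J : ℂ} (h : J ^ 2 + 1 = 2 * w * J) :
    Real.cosh (Real.log ‖J‖) = (‖w + 1‖ + ‖w - 1‖) / 2 := by
  have hJ : J ≠ 0 := by rintro rfl; simp at h
  have hJ' : 0 < ‖J‖ := norm_pos_iff.2 hJ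
  rw [Real.cosh_log hJ']
  have h1 : ‖J‖ * (2 * ‖w + 1‖) = ‖J + 1‖ ^ 2 := by
    rw [← norm_pow, show (J + 1) ^ 2 = J * (2 * (w + 1)) by linear_combination h]
    simp
  have h2 : ‖J‖ * (2 * ‖w - 1‖) = ‖J - 1‖ ^ 2 := by
    rw [← norm_pow, show (J - 1) ^ 2 = J * (2 * (w - 1)) by linear_combination h]
    simp
  have h3 := parallelogram_law_with_norm ℝ J 1
  simp only [norm_one] at h3
  field_simp
  nlinarith

theorem harmonicOnNhd_intervalGreen {a b : ℝ} (hab : a < b) :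
    HarmonicOnNhd (intervalGreen a b) ((fun t : ℝ => (t : ℂ)) '' Icc a b)ᶜ := by
  intro z₀ hz₀
  have hba : (b - a : ℂ) ≠ 0 := by
    have : (b - a : ℝ) ≠ 0 := (sub_pos.2 hab).ne'
    exact_mod_cast this
  set w : ℂ → ℂ := fun z => (2 * z - a - b) / (b - a) with hw
  -- The inverse Joukowski map in the affine coordinate `w` that sends `[a, b]` to `[-1, 1]`.
  -- Writing `√(w ^ 2 - 1)` as `(w + 1) √((z - b)/(z - a))` makes the principal branch analytic off
  -- `[a, b]`.
  set J : ℂ → ℂ := fun z => w z + (w z + 1) * ((z - b) / (z - a)) ^ (1 / 2 : ℂ) with hJdef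
  have hclosed : IsClosed ((fun t : ℝ => (t : ℂ)) '' Icc a b) :=
    (isCompact_Icc.image Complex.continuous_ofReal).isClosed
  have hJ : ∀ z ∉ (fun t : ℝ => (t : ℂ)) '' Icc a b, J z ^ 2 + 1 = 2 * w z * J z := by
    intro z hz
    have hza : z - a ≠ 0 := fun h => hz ⟨a, ⟨le_rfl, hab.le⟩, (sub_eq_zero.1 h).symm⟩
    have hs : (((z - b) / (z - a)) ^ (1 / 2 : ℂ)) ^ 2 = (z - b) / (z - a) := by
      rw [← Complex.cpow_nat_mul]; norm_num
    have hs2 : (w z + 1) ^ 2 * ((z - b) / (z - a)) = w z ^ 2 - 1 := by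
      simp only [hw]; field_simp; ring
    have : (J z - w z) ^ 2 = w z ^ 2 - 1 := by
      rw [← hs2, ← hs]; simp only [hJdef]; ring
    linear_combination this
  have heq : ∀ z ∉ (fun t : ℝ => (t : ℂ)) '' Icc a b,
      Real.cosh (Real.log ‖J z‖) = (‖z - a‖ + ‖z - b‖) / (b - a) := by
    intro z hz
    rw [cosh_log_norm_of_sq (hJ z hz)]
    have e1 : w z + 1 = (2 / (b - a : ℝ) : ℝ) * (z - a) := by
      simp only [hw]; push_cast; field_simp; ring
    have e2 : w z - 1 = (2 / (b - a : ℝ) : ℝ) * (z - b) := by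
      simp only [hw]; push_cast; field_simp; ring
    rw [e1, e2, norm_mul, norm_mul, Complex.norm_real,
      Real.norm_of_nonneg (div_nonneg zero_le_two (sub_pos.2 hab).le)]
    have := (sub_pos.2 hab).ne'
    field_simp
  have hJan : AnalyticAt ℂ J z₀ := by
    have hza : z₀ - a ≠ 0 := fun h => hz₀ ⟨a, ⟨le_rfl, hab.le⟩, (sub_eq_zero.1 h).symm⟩
    have hwan : AnalyticAt ℂ w z₀ := by simp only [hw]; fun_prop (disch := exact hba)
    refine hwan.add ((hwan.add analyticAt_const).mul ?_)
    refine AnalyticAt.cpow ?_ analyticAt_const (sub_div_sub_mem_slitPlane hab hz₀)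
    fun_prop (disch := exact hza)
  have hJ0 : J z₀ ≠ 0 := by
    intro h
    have := hJ z₀ hz₀
    simp [h] at this
  have hlog0 : Real.log ‖J z₀‖ ≠ 0 := by
    intro h
    have := heq z₀ hz₀
    rw [h, Real.cosh_zero, eq_comm, div_eq_one_iff_eq (sub_pos.2 hab).ne'] at this
    exact hz₀ (mem_of_norm_add_norm_le this.le)
  -- The Green function is the absolute value of `log ‖J‖`, so there is no need to know whether
  -- `‖J‖` exceeds `1`; it suffices that `log ‖J‖` does not vanish.
  refine (harmonicAt_congr_nhds ?_).1 ((hJan.harmonicAt_log_norm hJ0).abs_of_ne_zero hlog0)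
  filter_upwards [hclosed.isOpen_compl.mem_nhds hz₀] with z hz
  rw [intervalGreen, ← heq z hz, ← Real.cosh_abs, Real.arcosh_cosh (abs_nonneg _)]

theorem log_le_arcosh {s : ℝ} (hs : 1 ≤ s) : Real.log s ≤ Real.arcosh s :=
  Real.log_le_log (by linarith) (by linarith [Real.sqrt_nonneg (s ^ 2 - 1)])

theorem arcosh_le_log_two_mul {s : ℝ} (hs : 1 ≤ s) : Real.arcosh s ≤ Real.log (2 * s) := by
  have h := Real.sqrt_nonneg (s ^ 2 - 1)
  refine Real.log_le_log (by linarith) ?_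
  have : √(s ^ 2 - 1) ≤ s := Real.sqrt_le_iff.2 ⟨by linarith, by linarith⟩
  linarith

theorem intervalGreen_sub_log_isBigO {a b : ℝ} (hab : a < b) :
    Asymptotics.IsBigO (cocompact ℂ) (fun z => intervalGreen a b z - Real.log ‖z‖)
      (fun _ => (1 : ℝ)) := by
  refine Asymptotics.IsBigO.of_bound (|Real.log (b - a)| + Real.log 6) ?_
  filter_upwards [tendsto_norm_cocompact_atTop.eventually_ge_atTop (2 * (|a| + |b|) + 1)] with z hz
  have h1 := norm_sub_norm_le z (a : ℂ)
  have h2 := norm_sub_norm_le z (b : ℂ)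
  have h3 := norm_sub_le z (a : ℂ)
  have h4 := norm_sub_le z (b : ℂ)
  rw [Complex.norm_real, Real.norm_eq_abs] at h1 h2 h3 h4
  have ha := abs_nonneg a
  have hb := abs_nonneg b
  have hz0 : 0 < ‖z‖ := by linarith
  have hd := sub_pos.2 hab
  have hs := one_le_intervalGreen_arg hab z
  have l1 : Real.log (‖z‖ / (b - a)) ≤ intervalGreen a b z := by
    refine (Real.log_le_log (by positivity) ?_).trans (log_le_arcosh hs)
    gcongr; linarith
  have l2 : intervalGreen a b z ≤ Real.log (6 * ‖z‖ / (b - a)) := by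
    refine (arcosh_le_log_two_mul hs).trans (Real.log_le_log (by linarith) ?_)
    rw [← mul_div_assoc]
    exact div_le_div_of_nonneg_right (by linarith) hd.le
  rw [Real.log_div hz0.ne' hd.ne'] at l1
  rw [Real.log_div (by positivity) hd.ne', Real.log_mul (by norm_num) hz0.ne'] at l2
  have h6 : 0 ≤ Real.log 6 := Real.log_nonneg (by norm_num)
  have h7 := neg_abs_le (Real.log (b - a))
  have h8 := le_abs_self (Real.log (b - a))
  simp only [norm_one, mul_one, Real.norm_eq_abs]
  exact abs_le.2 ⟨by linarith, by linarith⟩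

theorem isGreenInfty_intervalGreen {a b : ℝ} (hab : a < b) :
    IsGreenInfty ((fun t : ℝ => (t : ℂ)) '' Icc a b) (intervalGreen a b) where
  harmonic := harmonicOnNhd_intervalGreen hab
  continuous := continuous_intervalGreen hab
  eq_zero := by rintro _ ⟨t, ht, rfl⟩; exact intervalGreen_of_mem hab ht
  log_pole := intervalGreen_sub_log_isBigO hab

theorem tendsto_log_norm_cocompact :
    Tendsto (fun z : ℂ => Real.log ‖z‖) (cocompact ℂ) atTop :=
  Real.tendsto_log_atTop.comp (tendsto_norm_cocompact_atTop (E := ℂ))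

theorem tendsto_intervalGreen {a b : ℝ} (hab : a < b) :
    Tendsto (intervalGreen a b) (cocompact ℂ) atTop := by
  obtain ⟨C, hC⟩ := (intervalGreen_sub_log_isBigO hab).bound
  refine tendsto_atTop_mono' _ ?_ (tendsto_atTop_add_const_right _ (-C) tendsto_log_norm_cocompact)
  filter_upwards [hC] with z hz
  simp only [norm_one, mul_one, Real.norm_eq_abs] at hz
  linarith [(abs_le.1 hz).1]

/-! ### Uniqueness and comparison of Green functions -/

/-- Maximum principle for functions bounded near infinity, on the complement of a set that
contains a real interval. -/
theorem nonpos_of_harmonicOnNhd_of_isBigO_one {E : Set ℂ} {u : ℂ → ℝ} {a b : ℝ} (hab : a < b)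
    (hE : (fun t : ℝ => (t : ℂ)) '' Icc a b ⊆ E) (hharm : HarmonicOnNhd u Eᶜ)
    (hcont : Continuous u) (hle : ∀ z ∈ E, u z ≤ 0)
    (hinf : Asymptotics.IsBigO (cocompact ℂ) u (fun _ => (1 : ℝ))) (z : ℂ) : u z ≤ 0 := by
  -- The interval Green function serves as a barrier: subtracting `η` times it forces decay to `-∞`,
  -- and then `η → 0`.
  have key : ∀ η > 0, u z - η * intervalGreen a b z ≤ 0 := by
    intro η hη
    refine nonpos_of_harmonicOnNhd_of_tendsto_atBot (E := E)
      (v := fun z => u z - η * intervalGreen a b z) ?_ ?_ ?_ ?_ z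
    · have h := (harmonicOnNhd_intervalGreen hab).mono (compl_subset_compl.2 hE)
      exact hharm.sub (h.const_smul (c := η))
    · exact hcont.sub (continuous_const.mul (continuous_intervalGreen hab))
    · intro y hy
      have := mul_nonneg hη.le (intervalGreen_nonneg hab y)
      linarith [hle y hy]
    · obtain ⟨C, hC⟩ := hinf.bound
      have h1 : Tendsto (fun z => C - η * intervalGreen a b z) (cocompact ℂ) atBot :=
        tendsto_atBot_add_const_left _ C
          (tendsto_neg_atTop_atBot.comp ((tendsto_intervalGreen hab).const_mul_atTop hη))
      refine tendsto_atBot_mono' _ ?_ h1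
      filter_upwards [hC] with y hy
      simp only [norm_one, mul_one, Real.norm_eq_abs] at hy
      linarith [(abs_le.1 hy).2]
  have hlim : Tendsto (fun η : ℝ => u z - η * intervalGreen a b z) (𝓝[>] 0) (𝓝 (u z)) := by
    have : Continuous fun η : ℝ => u z - η * intervalGreen a b z := by fun_prop
    simpa using (this.tendsto 0).mono_left nhdsWithin_le_nhds
  exact le_of_tendsto hlim (eventually_mem_nhdsWithin.mono key)

theorem IsGreenInfty.le {E : Set ℂ} {g g' : ℂ → ℝ} {a b : ℝ} (hab : a < b)
    (hE : (fun t : ℝ => (t : ℂ)) '' Icc a b ⊆ E) (hg : IsGreenInfty E g)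
    (hg' : IsGreenInfty E g') (z : ℂ) : g z ≤ g' z := by
  have := nonpos_of_harmonicOnNhd_of_isBigO_one (u := fun z => g z - g' z) hab hE
    (hg.harmonic.sub hg'.harmonic) (hg.continuous.sub hg'.continuous)
    (fun y hy => by simp [hg.eq_zero y hy, hg'.eq_zero y hy])
    (by simpa using hg.log_pole.sub hg'.log_pole) z
  linarith

theorem IsGreenInfty.greenInfty_eq {E : Set ℂ} {g : ℂ → ℝ} {a b : ℝ} (hab : a < b)
    (hE : (fun t : ℝ => (t : ℂ)) '' Icc a b ⊆ E) (hg : IsGreenInfty E g) :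
    greenInfty E = g := by
  have hex : ∃ g, IsGreenInfty E g := ⟨g, hg⟩
  have h : greenInfty E = hex.choose := dif_pos hex
  rw [h]
  exact funext fun z => le_antisymm (hex.choose_spec.le hab hE hg z) (hg.le hab hE hex.choose_spec z)

/-- Comparison of the Green function of a set containing two intervals with a combination of the
Green functions of these intervals. -/
theorem IsGreenInfty.le_combination {E : Set ℂ} {g : ℂ → ℝ} {p q r s : ℝ} {κ A : ℝ}
    (hpq : p < q) (hrs : r < s)
    (hE : E = (fun t : ℝ => (t : ℂ)) '' Icc p q ∪ (fun t : ℝ => (t : ℂ)) '' Icc r s)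
    (hg : IsGreenInfty E g) (hκ : 0 ≤ κ)
    (h₁ : ∀ t ∈ Icc p q, κ * A ≤ (1 - κ) * intervalGreen r s t)
    (h₂ : ∀ t ∈ Icc r s, A ≤ intervalGreen p q t) (z : ℂ) :
    g z ≤ (1 - κ) * intervalGreen r s z + κ * (intervalGreen p q z - A) := by
  have hE₁ : (fun t : ℝ => (t : ℂ)) '' Icc p q ⊆ E := hE ▸ subset_union_left
  have hE₂ : (fun t : ℝ => (t : ℂ)) '' Icc r s ⊆ E := hE ▸ subset_union_right
  -- The coefficients `1 - κ` and `κ` sum to one, so the logarithmic poles cancel and the difference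
  -- is bounded near infinity.
  have h := nonpos_of_harmonicOnNhd_of_isBigO_one (E := E)
    (u := fun z => g z - ((1 - κ) * intervalGreen r s z + κ * (intervalGreen p q z - A)))
    hpq hE₁ ?_ ?_ ?_ ?_ z
  · linarith
  · have k₁ := (harmonicOnNhd_intervalGreen hpq).mono (compl_subset_compl.2 hE₁)
    have k₂ := (harmonicOnNhd_intervalGreen hrs).mono (compl_subset_compl.2 hE₂)
    exact hg.harmonic.sub ((k₂.const_smul (c := 1 - κ)).add
      ((k₁.sub (harmonicOnNhd_const A)).const_smul (c := κ)))
  · have := hg.continuous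
    have := continuous_intervalGreen hpq
    have := continuous_intervalGreen hrs
    fun_prop
  · intro y hy
    simp only [hg.eq_zero y hy]
    rw [hE] at hy
    rcases hy with ⟨t, ht, rfl⟩ | ⟨t, ht, rfl⟩
    · have := h₁ t ht
      simp only [intervalGreen_of_mem hpq ht]; linarith
    · have := mul_le_mul_of_nonneg_left (h₂ t ht) hκ
      simp only [intervalGreen_of_mem hrs ht]; linarith
  · have k₁ := (intervalGreen_sub_log_isBigO hpq).const_mul_left κ
    have k₂ := (intervalGreen_sub_log_isBigO hrs).const_mul_left (1 - κ)
    have k₃ : Asymptotics.IsBigO (cocompact ℂ) (fun _ : ℂ => κ * A) (fun _ => (1 : ℝ)) :=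
      Asymptotics.isBigO_const_const _ one_ne_zero _
    refine (((hg.log_pole.sub k₂).sub k₁).add k₃).congr_left fun z => ?_
    ring

theorem IsGreenInfty.combination_le {E : Set ℂ} {g : ℂ → ℝ} {p q r s : ℝ} {κ A : ℝ}
    (hpq : p < q) (hrs : r < s)
    (hE : E = (fun t : ℝ => (t : ℂ)) '' Icc p q ∪ (fun t : ℝ => (t : ℂ)) '' Icc r s)
    (hg : IsGreenInfty E g) (hκ : 0 ≤ κ)
    (h₁ : ∀ t ∈ Icc p q, (1 - κ) * intervalGreen r s t ≤ κ * A)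
    (h₂ : ∀ t ∈ Icc r s, intervalGreen p q t ≤ A) (z : ℂ) :
    (1 - κ) * intervalGreen r s z + κ * (intervalGreen p q z - A) ≤ g z := by
  have hE₁ : (fun t : ℝ => (t : ℂ)) '' Icc p q ⊆ E := hE ▸ subset_union_left
  have hE₂ : (fun t : ℝ => (t : ℂ)) '' Icc r s ⊆ E := hE ▸ subset_union_right
  have h := nonpos_of_harmonicOnNhd_of_isBigO_one (E := E)
    (u := fun z => (1 - κ) * intervalGreen r s z + κ * (intervalGreen p q z - A) - g z)
    hpq hE₁ ?_ ?_ ?_ ?_ z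
  · linarith
  · have k₁ := (harmonicOnNhd_intervalGreen hpq).mono (compl_subset_compl.2 hE₁)
    have k₂ := (harmonicOnNhd_intervalGreen hrs).mono (compl_subset_compl.2 hE₂)
    exact HarmonicOnNhd.sub ((k₂.const_smul (c := 1 - κ)).add
      ((k₁.sub (harmonicOnNhd_const A)).const_smul (c := κ))) hg.harmonic
  · have := hg.continuous
    have := continuous_intervalGreen hpq
    have := continuous_intervalGreen hrs
    fun_prop
  · intro y hy
    simp only [hg.eq_zero y hy]
    rw [hE] at hy
    rcases hy with ⟨t, ht, rfl⟩ | ⟨t, ht, rfl⟩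
    · have := h₁ t ht
      simp only [intervalGreen_of_mem hpq ht]; linarith
    · have := mul_le_mul_of_nonneg_left (h₂ t ht) hκ
      simp only [intervalGreen_of_mem hrs ht]; linarith
  · have k₁ := (intervalGreen_sub_log_isBigO hpq).const_mul_left κ
    have k₂ := (intervalGreen_sub_log_isBigO hrs).const_mul_left (1 - κ)
    have k₃ : Asymptotics.IsBigO (cocompact ℂ) (fun _ : ℂ => κ * A) (fun _ => (1 : ℝ)) :=
      Asymptotics.isBigO_const_const _ one_ne_zero _
    refine (((k₂.add k₁).sub k₃).sub hg.log_pole).congr_left fun z => ?_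
    ring

/-! ### Primitives along vertical rays and their boundary values -/

/-- This majorant allows inverse square root singularities on the real axis and still decays
integrably at infinity. -/
theorem integrableOn_inv_sqrt_mul_one_add (M : ℝ) :
    IntegrableOn (fun y : ℝ => M / (√y * (1 + y))) (Ioi 0) := by
  have h : IntegrableOn (fun y : ℝ => 1 / (√y * (1 + y))) (Ioi 0) := by
    refine integrableOn_Ioi_deriv_of_nonneg (g := fun y => 2 * Real.arctan (√y))
      (l := 2 * (Real.pi / 2)) ?_ ?_ ?_ ?_
    · have : Continuous fun y : ℝ => 2 * Real.arctan (√y) := by fun_prop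
      exact this.continuousWithinAt
    · intro y hy
      have hy' : 0 < y := hy
      have hs : 0 < √y := Real.sqrt_pos.2 hy'
      have h1 := ((Real.hasDerivAt_sqrt hy'.ne').arctan).const_mul 2
      refine h1.congr_deriv ?_
      rw [Real.sq_sqrt hy'.le]
      field_simp
    · intro y hy
      have hy' : 0 < y := hy
      positivity
    · exact ((Real.tendsto_arctan_atTop.mono_right nhdsWithin_le_nhds).comp
        Real.tendsto_sqrt_atTop).const_mul 2
  refine IntegrableOn.congr_fun (h.const_mul M) (fun y _ => ?_) measurableSet_Ioi
  exact mul_one_div _ _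

theorem div_sqrt_mul_one_add_anti {M s y : ℝ} (hM : 0 ≤ M) (hs : 0 < s) (hsy : s ≤ y) :
    M / (√y * (1 + y)) ≤ M / (√s * (1 + s)) := by
  have := Real.sqrt_pos.2 hs
  gcongr

/-- The integral of `k` along the vertical ray going up from `z`. -/
noncomputable def rayIntegral (k : ℂ → ℂ) (z : ℂ) : ℂ :=
  ∫ s in Ioi (0 : ℝ), k (z + s * Complex.I)

section RayIntegral

variable {k : ℂ → ℂ} {M : ℝ}

theorem rayIntegral_bound (hk : ∀ w : ℂ, 0 < w.im → ‖k w‖ ≤ M / (√w.im * (1 + w.im)))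
    {z : ℂ} (hz : 0 ≤ z.im) {s : ℝ} (hs : 0 < s) :
    ‖k (z + s * Complex.I)‖ ≤ M / (√s * (1 + s)) := by
  have him : (z + s * Complex.I).im = z.im + s := by simp
  have hM : 0 ≤ M := by
    have h := (norm_nonneg _).trans (hk Complex.I (by simp))
    rw [Complex.I_im, Real.sqrt_one, one_mul] at h
    linarith
  refine (hk _ (by rw [him]; linarith)).trans ?_
  rw [him]
  exact div_sqrt_mul_one_add_anti hM hs (by linarith)

theorem continuousOn_ray (hd : DifferentiableOn ℂ k {w | 0 < w.im}) {z : ℂ} (hz : 0 ≤ z.im) :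
    ContinuousOn (fun s : ℝ => k (z + s * Complex.I)) (Ioi 0) := by
  refine hd.continuousOn.comp (by fun_prop) fun s hs => ?_
  have hs' : (0 : ℝ) < s := hs
  simp only [mem_ofPred_eq, Complex.add_im, Complex.mul_im, Complex.ofReal_re, Complex.I_im,
    Complex.ofReal_im, Complex.I_re]
  linarith

theorem integrableOn_ray (hd : DifferentiableOn ℂ k {w | 0 < w.im})
    (hk : ∀ w : ℂ, 0 < w.im → ‖k w‖ ≤ M / (√w.im * (1 + w.im))) {z : ℂ} (hz : 0 ≤ z.im) :
    IntegrableOn (fun s : ℝ => k (z + s * Complex.I)) (Ioi 0) :=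
  (integrableOn_inv_sqrt_mul_one_add M).mono'
    ((continuousOn_ray hd hz).aestronglyMeasurable measurableSet_Ioi)
    ((ae_restrict_iff' measurableSet_Ioi).2
      (Eventually.of_forall fun _ hs => rayIntegral_bound hk hz hs))

theorem norm_rayIntegral_le (hk : ∀ w : ℂ, 0 < w.im → ‖k w‖ ≤ M / (√w.im * (1 + w.im)))
    {z : ℂ} (hz : 0 ≤ z.im) :
    ‖rayIntegral k z‖ ≤ ∫ s in Ioi (0 : ℝ), M / (√s * (1 + s)) :=
  norm_integral_le_of_norm_le (integrableOn_inv_sqrt_mul_one_add M)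
    ((ae_restrict_iff' measurableSet_Ioi).2
      (Eventually.of_forall fun _ hs => rayIntegral_bound hk hz hs))

theorem continuousOn_rayIntegral (hd : DifferentiableOn ℂ k {w | 0 < w.im})
    (hk : ∀ w : ℂ, 0 < w.im → ‖k w‖ ≤ M / (√w.im * (1 + w.im))) :
    ContinuousOn (rayIntegral k) {z | 0 ≤ z.im} := by
  refine continuousOn_of_dominated (bound := fun s => M / (√s * (1 + s))) ?_ ?_
    (integrableOn_inv_sqrt_mul_one_add M) ?_
  · exact fun z hz => (continuousOn_ray hd hz).aestronglyMeasurable measurableSet_Ioi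
  · exact fun z hz => (ae_restrict_iff' measurableSet_Ioi).2
      (Eventually.of_forall fun _ hs => rayIntegral_bound hk hz hs)
  · refine (ae_restrict_iff' measurableSet_Ioi).2 (Eventually.of_forall fun s hs => ?_)
    refine hd.continuousOn.comp (by fun_prop) fun z hz => ?_
    have hs' : (0 : ℝ) < s := hs
    have hz' : 0 ≤ z.im := hz
    simp only [mem_ofPred_eq, Complex.add_im, Complex.mul_im, Complex.ofReal_re, Complex.I_im,
      Complex.ofReal_im, Complex.I_re]
    linarith

theorem isOpen_upperHalfPlane : IsOpen {w : ℂ | 0 < w.im} :=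
  isOpen_lt continuous_const Complex.continuous_im

theorem convex_upperHalfPlane : Convex ℝ {w : ℂ | 0 < w.im} :=
  convex_halfSpace_im_gt 0

/-- If `P` is a primitive of `k`, then `I * rayIntegral k z` is the limit of `P` up the ray minus `P
z`. That limit is the same for all rays, because at height `T` two rays are a fixed distance apart
and `k` tends to zero there. -/
theorem hasDerivAt_rayIntegral (hd : DifferentiableOn ℂ k {w | 0 < w.im})
    (hk : ∀ w : ℂ, 0 < w.im → ‖k w‖ ≤ M / (√w.im * (1 + w.im))) {z : ℂ} (hz : 0 < z.im) :
    HasDerivAt (rayIntegral k) (Complex.I * k z) z := by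
  obtain ⟨P, hP⟩ := convex_upperHalfPlane.exists_forall_hasDerivWithinAt hd
  have hP' : ∀ w : ℂ, 0 < w.im → HasDerivAt P (k w) w := fun w hw =>
    (hP w hw).hasDerivAt (isOpen_upperHalfPlane.mem_nhds hw)
  have him : ∀ (w : ℂ) (s : ℝ), (w + s * Complex.I).im = w.im + s := fun w s => by simp
  have hlim : ∀ w : ℂ, 0 < w.im →
      Tendsto (fun T : ℝ => P (w + T * Complex.I)) atTop
        (𝓝 (P w + Complex.I * rayIntegral k w)) := by
    intro w hw
    have h1 : ∀ T : ℝ, 0 ≤ T → P (w + T * Complex.I) =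
        P w + Complex.I * ∫ s in (0 : ℝ)..T, k (w + s * Complex.I) := by
      intro T hT
      have h2 : ∀ s ∈ uIcc 0 T, HasDerivAt (fun s : ℝ => P (w + s * Complex.I))
          (Complex.I * k (w + s * Complex.I)) s := by
        intro s hs
        rw [uIcc_of_le hT] at hs
        have h3 : HasDerivAt (fun s : ℝ => w + s * Complex.I) Complex.I s := by
          simpa using (((hasDerivAt_id s).ofReal_comp).mul_const Complex.I).const_add w
        have h4 := (hP' (w + s * Complex.I) (by rw [him]; linarith [hs.1])).scomp s h3
        simpa [smul_eq_mul, Function.comp_def] using h4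
      have h5 : IntervalIntegrable (fun s : ℝ => k (w + s * Complex.I)) volume 0 T := by
        refine (intervalIntegrable_iff_integrableOn_Ioc_of_le hT).2 ?_
        exact (integrableOn_ray hd hk hw.le).mono_set Ioc_subset_Ioi_self
      have h6 := intervalIntegral.integral_eq_sub_of_hasDerivAt h2 (h5.const_mul _)
      rw [intervalIntegral.integral_const_mul] at h6
      rw [h6]; simp
    have h7 := (intervalIntegral_tendsto_integral_Ioi 0 (integrableOn_ray hd hk hw.le)
      tendsto_id).const_mul Complex.I |>.const_add (P w)
    refine h7.congr' ?_
    filter_upwards [eventually_ge_atTop 0] with T hT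
    exact (h1 T hT).symm
  have hconst : ∀ w : ℂ, 0 < w.im →
      P w + Complex.I * rayIntegral k w = P z + Complex.I * rayIntegral k z := by
    intro w hw
    have h1 := (hlim w hw).sub (hlim z hz)
    have h2 : Tendsto (fun T : ℝ => P (w + T * Complex.I) - P (z + T * Complex.I)) atTop
        (𝓝 0) := by
      have h3 : Tendsto (fun T : ℝ => M / (√T * (1 + T)) * ‖w - z‖) atTop (𝓝 0) := by
        have : Tendsto (fun T : ℝ => √T * (1 + T)) atTop atTop :=
          Real.tendsto_sqrt_atTop.atTop_mul_atTop₀ (tendsto_atTop_add_const_left _ 1 tendsto_id)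
        simpa using (this.const_div_atTop M).mul_const ‖w - z‖
      refine squeeze_zero_norm' ?_ h3
      filter_upwards [eventually_gt_atTop 0] with T hT
      have hconv : Convex ℝ {v : ℂ | T ≤ v.im} := convex_halfSpace_im_ge T
      have hM : 0 ≤ M := by
        have h := (norm_nonneg _).trans (hk Complex.I (by simp))
        rw [Complex.I_im, Real.sqrt_one, one_mul] at h
        linarith
      have h4 := hconv.norm_image_sub_le_of_norm_hasDerivWithin_le (f := P) (f' := k)
        (C := M / (√T * (1 + T))) (x := z + T * Complex.I) (y := w + T * Complex.I)
        (fun v hv => (hP' v (hT.trans_le hv)).hasDerivWithinAt)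
        (fun v hv => (hk v (hT.trans_le hv)).trans (div_sqrt_mul_one_add_anti hM hT hv))
        (by change T ≤ _; rw [him]; linarith) (by change T ≤ _; rw [him]; linarith)
      simpa using h4
    exact sub_eq_zero.1 (tendsto_nhds_unique h1 h2)
  have heq : rayIntegral k =ᶠ[𝓝 z]
      fun w => rayIntegral k z + Complex.I * (P w - P z) := by
    filter_upwards [isOpen_upperHalfPlane.mem_nhds hz] with w hw
    have := hconst w hw
    linear_combination (-Complex.I) * this + (rayIntegral k w - rayIntegral k z) * Complex.I_sq
  exact ((((hP' z hz).sub_const (P z)).const_mul Complex.I).const_add _).congr_of_eventuallyEq heq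

/-- If the derivative of the real part of a primitive on the upper half plane along horizontal
lines has a limit at a real point, the boundary values are differentiable there. -/
theorem hasDerivAt_boundary {u : ℂ → ℝ} {F f : ℂ → ℂ} {x₀ m : ℝ}
    (hu : ContinuousOn u {z | 0 ≤ z.im}) (hF : ∀ z : ℂ, 0 < z.im → HasDerivAt F (f z) z)
    (huF : ∀ z : ℂ, 0 < z.im → u z = (F z).re)
    (hm : Tendsto (fun z => (f z).re) (𝓝[{z | 0 < z.im}] (x₀ : ℂ)) (𝓝 m)) :
    HasDerivAt (fun x : ℝ => u x) m x₀ := by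
  rw [hasDerivAt_iff_isLittleO, Asymptotics.isLittleO_iff]
  intro ε hε
  have h1 := hm.eventually (Metric.closedBall_mem_nhds m hε)
  rw [eventually_nhdsWithin_iff, Metric.eventually_nhds_iff_ball] at h1
  obtain ⟨ρ, hρ, h1⟩ := h1
  have hlim : ∀ x : ℝ, Tendsto (fun y : ℝ => u (x + y * Complex.I)) (𝓝[>] 0) (𝓝 (u x)) := by
    intro x
    have hx : Tendsto u (𝓝[{z | 0 ≤ z.im}] (x : ℂ)) (𝓝 (u x)) := hu (x : ℂ) (by simp)
    refine hx.comp (tendsto_nhdsWithin_iff.2 ⟨?_, ?_⟩)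
    · have : Continuous fun y : ℝ => (x : ℂ) + y * Complex.I := by fun_prop
      simpa using (this.tendsto 0).mono_left nhdsWithin_le_nhds
    · filter_upwards [self_mem_nhdsWithin] with y hy
      have : (0 : ℝ) < y := hy
      simpa using this.le
  filter_upwards [Metric.ball_mem_nhds x₀ (half_pos hρ)] with x hx
  -- A mean value estimate on the horizontal segment at height `y`, with a bound independent of `y`;
  -- continuity up to the boundary then allows `y → 0`.
  have key : ∀ᶠ y : ℝ in 𝓝[>] 0,
      ‖u (x + y * Complex.I) - u (x₀ + y * Complex.I) - m * (x - x₀)‖ ≤ ε * ‖x - x₀‖ := by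
    filter_upwards [Ioo_mem_nhdsGT (half_pos hρ)] with y hy
    have hconv : Convex ℝ (Metric.ball x₀ (ρ / 2)) := convex_ball _ _
    have h2 : ∀ t ∈ Metric.ball x₀ (ρ / 2),
        HasDerivWithinAt (fun t : ℝ => u (t + y * Complex.I) - m * t)
          ((f (t + y * Complex.I)).re - m) (Metric.ball x₀ (ρ / 2)) t := by
      intro t _
      have h3 : HasDerivAt (fun t : ℝ => (t : ℂ) + y * Complex.I) 1 t := by
        simpa using ((hasDerivAt_id t).ofReal_comp).add_const ((y : ℂ) * Complex.I)
      have h4 := (hF (t + y * Complex.I) (by simpa using hy.1)).scomp t h3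
      have h5 : HasDerivAt (fun t : ℝ => (F (t + y * Complex.I)).re)
          ((f (t + y * Complex.I)).re) t := by
        have := Complex.reCLM.hasFDerivAt.comp_hasDerivAt t h4
        simpa [Function.comp_def] using this
      have h6 : (fun t : ℝ => u (t + y * Complex.I) - m * t) =
          fun t : ℝ => (F (t + y * Complex.I)).re - m * t :=
        funext fun t => by rw [huF _ (by simpa using hy.1)]
      rw [h6]
      have h7 := (hasDerivAt_id t).const_mul m
      rw [mul_one] at h7
      exact (h5.sub h7).hasDerivWithinAt
    have h8 := hconv.norm_image_sub_le_of_norm_hasDerivWithin_le (C := ε) h2 ?_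
      (Metric.mem_ball_self (half_pos hρ)) hx
    · rw [show u (x + y * Complex.I) - u (x₀ + y * Complex.I) - m * (x - x₀) =
        u (x + y * Complex.I) - m * x - (u (x₀ + y * Complex.I) - m * x₀) by ring]
      exact h8
    · intro t ht
      have h9 := h1 (t + y * Complex.I) ?_ (by simpa using hy.1)
      · simpa [Real.dist_eq] using h9
      · rw [Metric.mem_ball, Real.dist_eq] at ht
        rw [Metric.mem_ball, dist_eq_norm]
        calc ‖(t : ℂ) + y * Complex.I - x₀‖ = ‖((t - x₀ : ℝ) : ℂ) + y * Complex.I‖ := by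
              congr 1; push_cast; ring
          _ ≤ |t - x₀| + |y| := by
              refine (norm_add_le _ _).trans ?_
              simp only [Complex.norm_real, norm_mul, Complex.norm_I, mul_one, Real.norm_eq_abs,
                le_refl]
          _ < ρ := by rw [abs_of_pos hy.1]; linarith [hy.2]
  have h10 := ((hlim x).sub (hlim x₀)).sub_const (m * (x - x₀)) |>.norm
  have h11 := le_of_tendsto h10 key
  simpa [smul_eq_mul, mul_comm] using h11

end RayIntegral

/-! ### Reflection across the real axis -/

open ComplexConjugate in
/-- Reflection principle: the even extension across the real axis of a function on the closed upper
half plane whose derivative there is symmetric under conjugation is harmonic. -/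
theorem harmonicOnNhd_reflect {u : ℂ → ℝ} {F f : ℂ → ℂ} {E : Set ℂ} (hEc : IsClosed E)
    (hu : ContinuousOn u {z | 0 ≤ z.im})
    (hF : ∀ z : ℂ, 0 < z.im → HasDerivAt F (f z) z) (huF : ∀ z : ℂ, 0 < z.im → u z = (F z).re)
    (hf : DifferentiableOn ℂ f Eᶜ) (hconj : ∀ z ∉ E, f (conj z) = conj (f z)) :
    HarmonicOnNhd (fun z : ℂ => u (z.re + |z.im| * Complex.I)) Eᶜ := by
  have hFd : DifferentiableOn ℂ F {z | 0 < z.im} :=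
    fun z hz => (hF z hz).differentiableAt.differentiableWithinAt
  have hup : ∀ z : ℂ, 0 ≤ z.im → (z.re + |z.im| * Complex.I : ℂ) = z := fun z hz => by
    rw [abs_of_nonneg hz]; exact Complex.re_add_im z
  have hdown : ∀ z : ℂ, z.im ≤ 0 → (z.re + |z.im| * Complex.I : ℂ) = conj z := fun z hz => by
    rw [abs_of_nonpos hz]; apply Complex.ext <;> simp
  intro z₀ hz₀
  rcases lt_trichotomy z₀.im 0 with h | h | h
  · have hz' : 0 < (conj z₀).im := by simpa using h
    have hdiff : DifferentiableOn ℂ (conj ∘ F ∘ conj) {z | z.im < 0} := fun z hz => by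
      have : 0 < (conj z).im := by simpa using hz
      have h1 := ((hF _ this).conj_conj).differentiableAt
      rw [Complex.conj_conj] at h1
      exact h1.differentiableWithinAt
    have hopen : IsOpen {z : ℂ | z.im < 0} := isOpen_lt Complex.continuous_im continuous_const
    have han := hdiff.analyticAt (hopen.mem_nhds h)
    refine (harmonicAt_congr_nhds ?_).1 han.harmonicAt_re
    filter_upwards [hopen.mem_nhds h] with z hz
    have : 0 < (conj z).im := by simpa using hz
    rw [hdown z (le_of_lt hz), huF _ this]
    simp
  -- At a real point off `E`, a primitive `P` of `f` exists on a whole ball. The symmetry of `f`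
  -- makes `Re P` even under conjugation, and `u` differs from `Re P` by a constant on the upper
  -- half of the ball, so the reflected function is `Re P` plus that constant.
  · obtain ⟨ρ, hρ, hball⟩ := Metric.isOpen_iff.1 hEc.isOpen_compl z₀ hz₀
    obtain ⟨P, hP⟩ := (hf.mono hball).isExactOn_ball
    have hreal : conj z₀ = z₀ := Complex.conj_eq_iff_im.2 h
    have hcball : ∀ z ∈ Metric.ball z₀ ρ, conj z ∈ Metric.ball z₀ ρ := fun z hz => by
      rw [Metric.mem_ball, dist_eq_norm] at hz ⊢
      rw [← hreal, ← map_sub, Complex.norm_conj]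
      exact hz
    have hPconj : ∀ z ∈ Metric.ball z₀ ρ, (P (conj z)).re = (P z).re := by
      have hd : ∀ z ∈ Metric.ball z₀ ρ,
          HasDerivWithinAt (fun z => (conj ∘ P ∘ conj) z - P z) 0 (Metric.ball z₀ ρ) z := by
        intro z hz
        have h1 := (hP (conj z) (hcball z hz)).conj_conj
        rw [Complex.conj_conj, hconj z (hball hz), Complex.conj_conj] at h1
        have h2 := h1.sub (hP z hz)
        rw [sub_self] at h2
        exact h2.hasDerivWithinAt
      intro z hz
      have h3 := (convex_ball z₀ ρ).norm_image_sub_le_of_norm_hasDerivWithin_le (C := 0) hd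
        (fun _ _ => by simp) (Metric.mem_ball_self hρ) hz
      rw [zero_mul, norm_le_zero_iff, sub_eq_zero] at h3
      have h4 := congrArg Complex.re h3
      simp only [Function.comp, Complex.sub_re, Complex.conj_re, hreal, sub_self] at h4
      linarith
    obtain ⟨C, hC⟩ : ∃ C : ℝ, ∀ z ∈ Metric.ball z₀ ρ, 0 < z.im → u z = (P z).re + C := by
      set D := Metric.ball z₀ ρ ∩ {z : ℂ | 0 < z.im}
      have hDconv : Convex ℝ D := (convex_ball z₀ ρ).inter convex_upperHalfPlane
      have hd : ∀ z ∈ D, HasDerivWithinAt (fun z => F z - P z) 0 D z := fun z hz => by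
        have h2 := (hF z hz.2).sub (hP z hz.1)
        rw [sub_self] at h2
        exact h2.hasDerivWithinAt
      set z₁ : ℂ := z₀ + (ρ / 2 : ℝ) * Complex.I
      have hz₁ : z₁ ∈ D := by
        constructor
        · simp [z₁, Metric.mem_ball, dist_eq_norm, abs_of_pos hρ, hρ]
        · simp [z₁, h, hρ]
      refine ⟨(F z₁ - P z₁).re, fun z hz hzim => ?_⟩
      have h3 := hDconv.norm_image_sub_le_of_norm_hasDerivWithin_le (C := 0) hd
        (fun _ _ => by simp) hz₁ ⟨hz, hzim⟩
      rw [zero_mul, norm_le_zero_iff, sub_eq_zero] at h3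
      rw [← h3, huF z hzim, Complex.sub_re]
      ring
    have hC' : ∀ z ∈ Metric.ball z₀ ρ, 0 ≤ z.im → u z = (P z).re + C := by
      intro z hz hzim
      have hc : Continuous fun t : ℝ => z + t * Complex.I := by fun_prop
      have hlim : Tendsto (fun t : ℝ => z + t * Complex.I) (𝓝[>] 0) (𝓝 z) := by
        simpa using (hc.tendsto 0).mono_left nhdsWithin_le_nhds
      have him : ∀ t : ℝ, 0 < t → 0 < (z + t * Complex.I).im := fun t ht => by
        simp only [Complex.add_im, Complex.mul_im, Complex.ofReal_re, Complex.I_im,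
          Complex.ofReal_im, Complex.I_re]
        linarith
      have h1 : Tendsto (fun t : ℝ => u (z + t * Complex.I)) (𝓝[>] 0) (𝓝 (u z)) := by
        refine Tendsto.comp (hu z hzim) (tendsto_nhdsWithin_iff.2 ⟨hlim, ?_⟩)
        filter_upwards [self_mem_nhdsWithin] with t ht
        exact (him t ht).le
      have h2 : Tendsto (fun t : ℝ => (P (z + t * Complex.I)).re + C) (𝓝[>] 0)
          (𝓝 ((P z).re + C)) :=
        ((Complex.continuous_re.tendsto _).comp
          ((hP z hz).continuousAt.tendsto.comp hlim)).add_const C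
      refine tendsto_nhds_unique (h1.congr' ?_) h2
      filter_upwards [hlim.eventually (Metric.isOpen_ball.mem_nhds hz), self_mem_nhdsWithin]
        with t ht ht'
      exact hC _ ht (him t ht')
    have hPan : AnalyticAt ℂ (fun z => P z + C) z₀ := by
      have : DifferentiableOn ℂ P (Metric.ball z₀ ρ) :=
        fun z hz => (hP z hz).differentiableAt.differentiableWithinAt
      exact (this.analyticAt (Metric.ball_mem_nhds z₀ hρ)).add analyticAt_const
    refine (harmonicAt_congr_nhds ?_).1 hPan.harmonicAt_re
    filter_upwards [Metric.ball_mem_nhds z₀ hρ] with z hz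
    rw [Complex.add_re, Complex.ofReal_re]
    rcases le_total 0 z.im with hz' | hz'
    · rw [hup z hz', hC' z hz hz']
    · rw [hdown z hz', hC' _ (hcball z hz) (by simpa using hz'), hPconj z hz]
  · refine (harmonicAt_congr_nhds ?_).1
      (hFd.analyticAt (isOpen_upperHalfPlane.mem_nhds h)).harmonicAt_re
    filter_upwards [isOpen_upperHalfPlane.mem_nhds h] with z hz
    rw [hup z (le_of_lt hz), huF z hz]

/-! ### The square root of the quartic -/

/-- The branch of the square root of `(z - p) (z - q) (z - r) (z - s)` that is analytic off
`[p, q] ∪ [r, s]` and asymptotic to `z ^ 2`. -/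
noncomputable def quarticRoot (p q r s : ℝ) (z : ℂ) : ℂ :=
  (z - p) * (z - r) * ((z - q) / (z - p)) ^ (1 / 2 : ℂ) * ((z - s) / (z - r)) ^ (1 / 2 : ℂ)

section QuarticRoot

variable {p q r s : ℝ}

theorem cpow_half_sq (z : ℂ) : (z ^ (1 / 2 : ℂ)) ^ 2 = z := by
  rw [← Complex.cpow_nat_mul]; norm_num

theorem quarticRoot_sq {z : ℂ} (hp : z ≠ p) (hr : z ≠ r) :
    quarticRoot p q r s z ^ 2 = (z - p) * (z - q) * (z - r) * (z - s) := by
  have hp' := sub_ne_zero.2 hp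
  have hr' := sub_ne_zero.2 hr
  rw [quarticRoot, mul_pow, mul_pow, cpow_half_sq, cpow_half_sq]
  field_simp

theorem ne_ofReal_of_im_pos {z : ℂ} (hz : 0 < z.im) (x : ℝ) : z ≠ x := by
  rintro rfl; simp at hz

theorem ne_left_of_notMem (hpq : p < q) {z : ℂ} (hz : z ∉ (fun t : ℝ => (t : ℂ)) '' Icc p q) :
    z ≠ p := fun h => hz ⟨p, ⟨le_rfl, hpq.le⟩, h.symm⟩

theorem differentiableAt_quarticRoot (hpq : p < q) (hrs : r < s) {z : ℂ}
    (h₁ : z ∉ (fun t : ℝ => (t : ℂ)) '' Icc p q) (h₂ : z ∉ (fun t : ℝ => (t : ℂ)) '' Icc r s) :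
    DifferentiableAt ℂ (quarticRoot p q r s) z := by
  have hp := sub_ne_zero.2 (ne_left_of_notMem hpq h₁)
  have hr := sub_ne_zero.2 (ne_left_of_notMem hrs h₂)
  have d₁ : DifferentiableAt ℂ (fun z : ℂ => ((z - q) / (z - p)) ^ (1 / 2 : ℂ)) z :=
    DifferentiableAt.cpow (by fun_prop (disch := exact hp)) (by fun_prop)
      (sub_div_sub_mem_slitPlane hpq h₁)
  have d₂ : DifferentiableAt ℂ (fun z : ℂ => ((z - s) / (z - r)) ^ (1 / 2 : ℂ)) z :=
    DifferentiableAt.cpow (by fun_prop (disch := exact hr)) (by fun_prop)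
      (sub_div_sub_mem_slitPlane hrs h₂)
  unfold quarticRoot
  fun_prop

theorem quarticRoot_ne_zero (hpq : p < q) (hrs : r < s) {z : ℂ}
    (h₁ : z ∉ (fun t : ℝ => (t : ℂ)) '' Icc p q) (h₂ : z ∉ (fun t : ℝ => (t : ℂ)) '' Icc r s) :
    quarticRoot p q r s z ≠ 0 := by
  have hp := ne_left_of_notMem hpq h₁
  have hr := ne_left_of_notMem hrs h₂
  have hq : z ≠ q := fun h => h₁ ⟨q, ⟨hpq.le, le_rfl⟩, h.symm⟩
  have hs : z ≠ s := fun h => h₂ ⟨s, ⟨hrs.le, le_rfl⟩, h.symm⟩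
  intro h
  have := quarticRoot_sq (q := q) (s := s) hp hr
  rw [h, eq_comm] at this
  simp [sub_eq_zero, hp, hq, hr, hs] at this

open ComplexConjugate in
theorem quarticRoot_conj (hpq : p < q) (hrs : r < s) {z : ℂ}
    (h₁ : z ∉ (fun t : ℝ => (t : ℂ)) '' Icc p q) (h₂ : z ∉ (fun t : ℝ => (t : ℂ)) '' Icc r s) :
    quarticRoot p q r s (conj z) = conj (quarticRoot p q r s z) := by
  have a₁ := Complex.slitPlane_arg_ne_pi (sub_div_sub_mem_slitPlane hpq h₁)
  have a₂ := Complex.slitPlane_arg_ne_pi (sub_div_sub_mem_slitPlane hrs h₂)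
  have c₁ := Complex.conj_cpow ((z - q) / (z - p)) (1 / 2) a₁
  have c₂ := Complex.conj_cpow ((z - s) / (z - r)) (1 / 2) a₂
  simp only [map_div₀, map_sub, Complex.conj_ofReal, map_one, map_ofNat] at c₁ c₂
  simp only [quarticRoot, map_mul, map_sub, Complex.conj_ofReal, c₁, c₂]

theorem im_le_norm_sub_ofReal {w : ℂ} (x : ℝ) : w.im ≤ ‖w - x‖ := by
  simpa using Complex.im_le_norm (w - x)

/-- Both factors are at least `w.im`, and the larger is at least half of `q - p` by the triangle
inequality. -/
theorem mul_le_norm_sub_mul_norm_sub (hpq : p < q) {w : ℂ} (hw : 0 < w.im) :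
    w.im * ((q - p) / 2) ≤ ‖w - p‖ * ‖w - q‖ := by
  have h1 := im_le_norm_sub_ofReal (w := w) p
  have h2 := im_le_norm_sub_ofReal (w := w) q
  have h3 := norm_sub_le (w - p) (w - q)
  rw [show w - p - (w - q) = ((q - p : ℝ) : ℂ) by push_cast; ring, Complex.norm_real,
    Real.norm_of_nonneg (by linarith)] at h3
  rcases le_total ‖w - p‖ ‖w - q‖ with h | h <;> nlinarith

theorem le_norm_sub_of_re {w : ℂ} {x d : ℝ} (hd : d ≤ |w.re - x|) : d ≤ ‖w - x‖ := by
  refine hd.trans ?_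
  simpa using Complex.abs_re_le_norm (w - x)

theorem exists_le_norm_quarticRoot_sq (hpq : p < q) (hqr : q < r) (hrs : r < s) :
    ∃ c > 0, ∀ w : ℂ, 0 < w.im → c * w.im ≤ ‖quarticRoot p q r s w‖ ^ 2 := by
  set d := (r - q) / 2 with hd
  have hd0 : 0 < d := by rw [hd]; linarith
  refine ⟨d ^ 2 * min ((q - p) / 2) ((s - r) / 2),
    mul_pos (by positivity) (lt_min (by linarith) (by linarith)), fun w hw => ?_⟩
  rw [← norm_pow, quarticRoot_sq (ne_ofReal_of_im_pos hw p) (ne_ofReal_of_im_pos hw r)]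
  simp only [norm_mul]
  have h1 := mul_le_norm_sub_mul_norm_sub hpq hw
  have h2 := mul_le_norm_sub_mul_norm_sub hrs hw
  have m1 := min_le_left ((q - p) / 2) ((s - r) / 2)
  have m2 := min_le_right ((q - p) / 2) ((s - r) / 2)
  -- On either side of the middle of the gap, the two endpoints of the far interval stay at distance
  -- at least `d`.
  rcases le_total w.re ((q + r) / 2) with h | h
  · have e1 : d ≤ ‖w - r‖ := le_norm_sub_of_re (le_abs.2 (Or.inr (by rw [hd]; linarith)))
    have e2 : d ≤ ‖w - s‖ := le_norm_sub_of_re (le_abs.2 (Or.inr (by rw [hd]; linarith)))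
    calc _ ≤ (w.im * ((q - p) / 2)) * (d * d) := by
          have := mul_le_mul_of_nonneg_left m1 (mul_nonneg (sq_nonneg d) hw.le)
          linarith
      _ ≤ (‖w - p‖ * ‖w - q‖) * (‖w - r‖ * ‖w - s‖) := by gcongr
      _ = _ := by ring
  · have e1 : d ≤ ‖w - p‖ := le_norm_sub_of_re (le_abs.2 (Or.inl (by rw [hd]; linarith)))
    have e2 : d ≤ ‖w - q‖ := le_norm_sub_of_re (le_abs.2 (Or.inl (by rw [hd]; linarith)))
    calc _ ≤ (d * d) * (w.im * ((s - r) / 2)) := by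
          have := mul_le_mul_of_nonneg_left m2 (mul_nonneg (sq_nonneg d) hw.le)
          linarith
      _ ≤ (‖w - p‖ * ‖w - q‖) * (‖w - r‖ * ‖w - s‖) := by gcongr
      _ = _ := by ring

theorem exists_norm_inv_quarticRoot_le (hpq : p < q) (hqr : q < r) (hrs : r < s) :
    ∃ D > 0, ∀ w : ℂ, 0 < w.im → ‖(quarticRoot p q r s w)⁻¹‖ ≤ D / √w.im := by
  obtain ⟨c, hc, h⟩ := exists_le_norm_quarticRoot_sq hpq hqr hrs
  refine ⟨(√c)⁻¹, by positivity, fun w hw => ?_⟩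
  have h1 := Real.le_sqrt_of_sq_le (x := √(c * w.im)) (y := ‖quarticRoot p q r s w‖ ^ 2)
    (by rw [Real.sq_sqrt (by positivity)]; exact h w hw)
  rw [Real.sqrt_sq (norm_nonneg _), Real.sqrt_mul hc.le] at h1
  rw [norm_inv, div_eq_mul_inv, ← mul_inv]
  have := Real.sqrt_pos.2 hc
  have := Real.sqrt_pos.2 hw
  gcongr

/-- `quarticRoot` near infinity, in the coordinate `1 / z` and divided by `z ^ 2`. -/
theorem quarticRoot_eq_sq_mul {w : ℂ} (hw : w ≠ 0) :
    quarticRoot p q r s w = w ^ 2 * ((1 - p * w⁻¹) * (1 - r * w⁻¹) *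
      ((1 - q * w⁻¹) / (1 - p * w⁻¹)) ^ (1 / 2 : ℂ) *
      ((1 - s * w⁻¹) / (1 - r * w⁻¹)) ^ (1 / 2 : ℂ)) := by
  have h : ∀ x : ℝ, w - x = w * (1 - x * w⁻¹) := fun x => by field_simp
  rw [quarticRoot, h p, h q, h r, h s, mul_div_mul_left _ _ hw, mul_div_mul_left _ _ hw]
  ring

theorem differentiableAt_quarticRoot_infty :
    DifferentiableAt ℂ (fun ζ : ℂ => ((1 - p * ζ) * (1 - r * ζ) *
      ((1 - q * ζ) / (1 - p * ζ)) ^ (1 / 2 : ℂ) *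
      ((1 - s * ζ) / (1 - r * ζ)) ^ (1 / 2 : ℂ))⁻¹) 0 := by
  have d : ∀ x y : ℝ, DifferentiableAt ℂ (fun ζ : ℂ => ((1 - x * ζ) / (1 - y * ζ)) ^ (1 / 2 : ℂ)) 0 :=
    fun x y => DifferentiableAt.cpow (by fun_prop (disch := simp)) (by fun_prop) (by simp)
  have d₁ := d q p
  have d₂ := d s r
  refine DifferentiableAt.inv (by fun_prop) (by simp)

theorem tendsto_inv_cocompact : Tendsto (fun w : ℂ => w⁻¹) (cocompact ℂ) (𝓝 0) := by
  rw [← Metric.cobounded_eq_cocompact]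
  exact tendsto_inv₀_cobounded

theorem inv_quarticRoot_isBigO :
    Asymptotics.IsBigO (cocompact ℂ) (fun w => (quarticRoot p q r s w)⁻¹)
      (fun w => (w⁻¹) ^ 2) := by
  have h1 := (differentiableAt_quarticRoot_infty (p := p) (q := q) (r := r) (s := s)).continuousAt
    |>.tendsto.isBigO_one ℂ |>.comp_tendsto tendsto_inv_cocompact
  have h2 := (Asymptotics.isBigO_refl (fun w : ℂ => (w⁻¹) ^ 2) (cocompact ℂ)).mul h1
  refine (h2.congr' ?_ ?_)
  · filter_upwards [(isCompact_singleton (x := (0 : ℂ))).compl_mem_cocompact] with w hw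
    replace hw : w ≠ 0 := hw
    rw [quarticRoot_eq_sq_mul hw, mul_inv (w ^ 2), inv_pow]
    rfl
  · exact Eventually.of_forall fun w => by simp

/-- The quotient `w / quarticRoot w` behaves like `1 / w`, which is not integrable along a ray.
Subtracting `1 / (w + I)`, whose primitive is an explicit logarithm and whose pole lies below the
real axis, gains one order. -/
theorem div_quarticRoot_sub_isBigO :
    Asymptotics.IsBigO (cocompact ℂ)
      (fun w => w * (quarticRoot p q r s w)⁻¹ - (w + Complex.I)⁻¹)
      (fun w => (w⁻¹) ^ 2) := by
  have hd : DifferentiableAt ℂ (fun ζ : ℂ => ((1 - p * ζ) * (1 - r * ζ) *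
      ((1 - q * ζ) / (1 - p * ζ)) ^ (1 / 2 : ℂ) *
      ((1 - s * ζ) / (1 - r * ζ)) ^ (1 / 2 : ℂ))⁻¹ - (1 + Complex.I * ζ)⁻¹) 0 :=
    differentiableAt_quarticRoot_infty.sub (by fun_prop (disch := simp))
  have h1 := hd.isBigO_sub.comp_tendsto tendsto_inv_cocompact
  have h2 := (Asymptotics.isBigO_refl (fun w : ℂ => w⁻¹) (cocompact ℂ)).mul h1
  refine (h2.congr' ?_ ?_)
  · filter_upwards [(isCompact_singleton (x := (0 : ℂ))).compl_mem_cocompact] with w hw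
    replace hw : w ≠ 0 := hw
    rw [quarticRoot_eq_sq_mul hw, mul_inv (w ^ 2),
      show w + Complex.I = w * (1 + Complex.I * w⁻¹) by field_simp, mul_inv w]
    simp only [Function.comp, mul_zero, sub_zero, div_one, Complex.one_cpow, mul_one, inv_one,
      add_zero, sub_self]
    generalize ((1 - p * w⁻¹) * (1 - r * w⁻¹) *
      ((1 - q * w⁻¹) / (1 - p * w⁻¹)) ^ (1 / 2 : ℂ) *
      ((1 - s * w⁻¹) / (1 - r * w⁻¹)) ^ (1 / 2 : ℂ))⁻¹ = X
    field_simp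
  · exact Eventually.of_forall fun w => by simp [sq]

theorem exists_bound_of_isBigO {k : ℂ → ℂ}
    (hk : Asymptotics.IsBigO (cocompact ℂ) k (fun w => (w⁻¹) ^ 2))
    (hloc : ∀ R > 0, ∃ D, ∀ w : ℂ, 0 < w.im → ‖w‖ ≤ R → ‖k w‖ ≤ D / √w.im) :
    ∃ M, ∀ w : ℂ, 0 < w.im → ‖k w‖ ≤ M / (√w.im * (1 + w.im)) := by
  obtain ⟨C, hC0, hC⟩ := hk.exists_pos
  have hb := hC.bound
  rw [← Metric.cobounded_eq_cocompact, ← comap_norm_atTop, eventually_comap,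
    eventually_atTop] at hb
  obtain ⟨R₀, hR₀⟩ := hb
  set R := max R₀ 1
  obtain ⟨D, hD⟩ := hloc R (by positivity)
  refine ⟨2 * C + |D| * (1 + R), fun w hw => ?_⟩
  have hy := Real.sqrt_pos.2 hw
  rcases le_or_gt ‖w‖ R with h | h
  · have hwR : w.im ≤ R := (Complex.im_le_norm w).trans h
    refine (hD w hw h).trans ?_
    rw [div_le_div_iff₀ hy (by positivity)]
    have h1 : D * (1 + w.im) ≤ |D| * (1 + R) :=
      mul_le_mul (le_abs_self D) (by linarith) (by linarith) (abs_nonneg D)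
    nlinarith
  · have hw1 : 1 < ‖w‖ := (le_max_right R₀ 1).trans_lt h
    have hyw := Complex.im_le_norm w
    have h0 : 0 < ‖w‖ := by linarith
    refine (hR₀ ‖w‖ ((le_max_left R₀ 1).trans h.le) w rfl).trans ?_
    refine le_trans ?_ (div_sqrt_mul_one_add_anti (by positivity) hw hyw)
    rw [norm_pow, norm_inv, inv_pow, ← div_eq_mul_inv, div_le_div_iff₀ (by positivity)
      (by positivity)]
    have h1 : √‖w‖ ≤ ‖w‖ := Real.sqrt_le_iff.2 ⟨h0.le, by nlinarith⟩
    have h2 : √‖w‖ * (1 + ‖w‖) ≤ ‖w‖ * (2 * ‖w‖) :=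
      mul_le_mul h1 (by linarith) (by linarith) h0.le
    have h3 : 0 ≤ |D| * (1 + R) := by positivity
    calc C * (√‖w‖ * (1 + ‖w‖)) ≤ C * (‖w‖ * (2 * ‖w‖)) := by gcongr
      _ = 2 * C * ‖w‖ ^ 2 := by ring
      _ ≤ _ := by gcongr; linarith

theorem exists_bound_inv_quarticRoot (hpq : p < q) (hqr : q < r) (hrs : r < s) :
    ∃ M, ∀ w : ℂ, 0 < w.im →
      ‖(quarticRoot p q r s w)⁻¹‖ ≤ M / (√w.im * (1 + w.im)) := by
  obtain ⟨D, -, hD⟩ := exists_norm_inv_quarticRoot_le hpq hqr hrs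
  exact exists_bound_of_isBigO inv_quarticRoot_isBigO fun R _ => ⟨D, fun w hw _ => hD w hw⟩

theorem exists_bound_div_quarticRoot_sub (hpq : p < q) (hqr : q < r) (hrs : r < s) :
    ∃ M, ∀ w : ℂ, 0 < w.im →
      ‖w * (quarticRoot p q r s w)⁻¹ - (w + Complex.I)⁻¹‖ ≤ M / (√w.im * (1 + w.im)) := by
  obtain ⟨D, hD0, hD⟩ := exists_norm_inv_quarticRoot_le hpq hqr hrs
  refine exists_bound_of_isBigO div_quarticRoot_sub_isBigO
    fun R hR => ⟨R * D + √R, fun w hw hwR => ?_⟩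
  have hy := Real.sqrt_pos.2 hw
  have h1 : (1 : ℝ) ≤ ‖w + Complex.I‖ := by
    have := Complex.im_le_norm (w + Complex.I)
    simp only [Complex.add_im, Complex.I_im] at this
    linarith
  have h2 : ‖(w + Complex.I)⁻¹‖ ≤ √R / √w.im := by
    rw [norm_inv]
    refine (inv_le_one_of_one_le₀ h1).trans ((one_le_div hy).2 ?_)
    exact Real.sqrt_le_sqrt ((Complex.im_le_norm w).trans hwR)
  calc _ ≤ ‖w‖ * ‖(quarticRoot p q r s w)⁻¹‖ + ‖(w + Complex.I)⁻¹‖ := by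
        rw [← norm_mul]; exact norm_sub_le _ _
    _ ≤ R * (D / √w.im) + √R / √w.im := by
        have := hD w hw
        gcongr
    _ = _ := by ring

theorem quarticRoot_of_mem_gap {t : ℝ} (hpq : p < q) (hrs : r < s) (ht : t ∈ Ioo q r) :
    ∃ x : ℝ, x < 0 ∧ quarticRoot p q r s t = x := by
  have h1 : 0 < (t - q) / (t - p) := div_pos (by linarith [ht.1]) (by linarith [ht.1])
  have h2 : 0 < (t - s) / (t - r) := div_pos_of_neg_of_neg (by linarith [ht.2]) (by linarith [ht.2])
  refine ⟨(t - p) * (t - r) * ((t - q) / (t - p)) ^ (1 / 2 : ℝ) *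
    ((t - s) / (t - r)) ^ (1 / 2 : ℝ), ?_, ?_⟩
  · have h3 : (t - p) * (t - r) < 0 := mul_neg_of_pos_of_neg (by linarith [ht.1]) (by linarith [ht.2])
    have h4 := Real.rpow_pos_of_pos h1 (1 / 2)
    have h5 := Real.rpow_pos_of_pos h2 (1 / 2)
    exact mul_neg_of_neg_of_pos (mul_neg_of_neg_of_pos h3 h4) h5
  · rw [quarticRoot]
    push_cast [Complex.ofReal_cpow h1.le, Complex.ofReal_cpow h2.le]
    norm_num

/-- The real part of `(w - c) / quarticRoot w` tends to zero at interior points of the intervals. -/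
theorem tendsto_re_div_quarticRoot (c : ℝ) {t : ℝ}
    (ht : (t - p) * (t - q) * (t - r) * (t - s) < 0) :
    Tendsto (fun w : ℂ => ((w - c) * (quarticRoot p q r s w)⁻¹).re) (𝓝[{w | 0 < w.im}] (t : ℂ))
      (𝓝 0) := by
  set X : ℂ → ℂ := fun w => (w - c) ^ 2 * ((w - p) * (w - q) * (w - r) * (w - s))⁻¹ with hX
  have hne : ((t : ℂ) - p) * (t - q) * (t - r) * (t - s) ≠ 0 := by exact_mod_cast ht.ne
  have hcont : ContinuousAt (fun w => (‖X w‖ + (X w).re) / 2) t := by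
    have : ContinuousAt X t := by
      simp only [hX]
      exact ContinuousAt.mul (by fun_prop) (ContinuousAt.inv₀ (by fun_prop) hne)
    have h2 : ContinuousAt (fun w => (X w).re) t := Complex.continuous_re.continuousAt.comp this
    exact (this.norm.add h2).div_const 2
  have hXt : X t = (((t - c) ^ 2 * ((t - p) * (t - q) * (t - r) * (t - s))⁻¹ : ℝ) : ℂ) := by
    simp only [hX]; push_cast; ring
  have hval : (‖X t‖ + (X t).re) / 2 = 0 := by
    have : (t - c) ^ 2 * ((t - p) * (t - q) * (t - r) * (t - s))⁻¹ ≤ 0 :=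
      mul_nonpos_of_nonneg_of_nonpos (sq_nonneg _) (inv_nonpos.2 ht.le)
    rw [hXt, Complex.norm_real, Complex.ofReal_re, Real.norm_of_nonpos this]
    ring
  have hlim : Tendsto (fun w => √((‖X w‖ + (X w).re) / 2)) (𝓝[{w | 0 < w.im}] (t : ℂ)) (𝓝 0) := by
    have := (hcont.tendsto.mono_left nhdsWithin_le_nhds : Tendsto _ (𝓝[{w | 0 < w.im}] (t : ℂ)) _)
    rw [hval] at this
    simpa using this.sqrt
  refine squeeze_zero_norm' ?_ hlim
  filter_upwards [self_mem_nhdsWithin] with w hw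
  replace hw : 0 < w.im := hw
  -- The square is a rational function, real and nonpositive at `t`. With `(Re Y) ^ 2 = (|Y ^ 2| +
  -- Re (Y ^ 2)) / 2`, this avoids following the branch of the root to its cut.
  have hsq : ((w - c) * (quarticRoot p q r s w)⁻¹) ^ 2 = X w := by
    rw [mul_pow, inv_pow, quarticRoot_sq (ne_ofReal_of_im_pos hw p) (ne_ofReal_of_im_pos hw r)]
  generalize (w - c) * (quarticRoot p q r s w)⁻¹ = Y at hsq ⊢
  refine Real.le_sqrt_of_sq_le ?_
  rw [← hsq, norm_pow, ← Complex.normSq_eq_norm_sq, Complex.normSq_apply, Real.norm_eq_abs, sq_abs,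
    sq Y, Complex.mul_re]
  apply le_of_eq
  ring

end QuarticRoot

/-! ### The Green function of two intervals -/

theorem eq_of_hasDerivAt_zero_Ioo {f : ℝ → ℝ} {a b : ℝ} (hc : ContinuousOn f (Icc a b))
    (hd : ∀ t ∈ Ioo a b, HasDerivAt f 0 t) {t : ℝ} (ht : t ∈ Icc a b) : f t = f a := by
  rcases ht.1.eq_or_lt with rfl | hat
  · rfl
  obtain ⟨x, -, hx⟩ := exists_hasDerivAt_eq_slope f (fun _ => 0) hat
    (hc.mono (Icc_subset_Icc_right ht.2)) fun x hx => hd x ⟨hx.1, hx.2.trans_le ht.2⟩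
  rw [eq_comm, div_eq_zero_iff] at hx
  rcases hx with h | h <;> linarith

section TwoIntervalGreen

variable {p q r s : ℝ}

/-- The real part of a primitive of `(z - c) / quarticRoot z` on the closed upper half plane. -/
noncomputable def quarticPotential (p q r s c : ℝ) (z : ℂ) : ℝ :=
  Real.log ‖z + Complex.I‖ +
    (rayIntegral (fun w => w * (quarticRoot p q r s w)⁻¹ - (w + Complex.I)⁻¹) z).im -
    c * (rayIntegral (fun w => (quarticRoot p q r s w)⁻¹) z).im

theorem notMem_ofReal_image_of_im_pos {S : Set ℝ} {z : ℂ} (hz : 0 < z.im) :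
    z ∉ (fun t : ℝ => (t : ℂ)) '' S := by
  rintro ⟨t, _, rfl⟩; simp at hz

theorem add_I_ne_zero {z : ℂ} (hz : 0 ≤ z.im) : z + Complex.I ≠ 0 := fun h => by
  have := congrArg Complex.im h
  simp at this; linarith

theorem differentiableOn_inv_quarticRoot (hpq : p < q) (hrs : r < s) :
    DifferentiableOn ℂ (fun w => (quarticRoot p q r s w)⁻¹) {w | 0 < w.im} := fun _ hw =>
  ((differentiableAt_quarticRoot hpq hrs (notMem_ofReal_image_of_im_pos hw)
    (notMem_ofReal_image_of_im_pos hw)).inv (quarticRoot_ne_zero hpq hrs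
    (notMem_ofReal_image_of_im_pos hw)
    (notMem_ofReal_image_of_im_pos hw))).differentiableWithinAt

theorem differentiableOn_div_quarticRoot_sub (hpq : p < q) (hrs : r < s) :
    DifferentiableOn ℂ (fun w => w * (quarticRoot p q r s w)⁻¹ - (w + Complex.I)⁻¹)
      {w | 0 < w.im} := by
  refine (differentiableOn_id.mul (differentiableOn_inv_quarticRoot hpq hrs)).sub
    (DifferentiableOn.inv (by fun_prop) fun w hw => add_I_ne_zero (le_of_lt hw))

theorem continuousOn_quarticPotential (hpq : p < q) (hqr : q < r) (hrs : r < s) (c : ℝ) :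
    ContinuousOn (quarticPotential p q r s c) {z | 0 ≤ z.im} := by
  obtain ⟨M₁, h₁⟩ := exists_bound_inv_quarticRoot hpq hqr hrs
  obtain ⟨M₂, h₂⟩ := exists_bound_div_quarticRoot_sub hpq hqr hrs
  have k₁ := continuousOn_rayIntegral (differentiableOn_inv_quarticRoot hpq hrs) h₁
  have k₂ := continuousOn_rayIntegral (differentiableOn_div_quarticRoot_sub hpq hrs) h₂
  refine ((ContinuousOn.log (by fun_prop) fun z hz => norm_ne_zero_iff.2 (add_I_ne_zero hz)).add
    (Complex.continuous_im.comp_continuousOn k₂)).sub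
    (continuousOn_const.mul (Complex.continuous_im.comp_continuousOn k₁))

theorem exists_hasDerivAt_quarticPotential (hpq : p < q) (hqr : q < r) (hrs : r < s) (c : ℝ) :
    ∃ F : ℂ → ℂ,
      (∀ z : ℂ, 0 < z.im → HasDerivAt F ((z - c) * (quarticRoot p q r s z)⁻¹) z) ∧
      ∀ z : ℂ, 0 < z.im → quarticPotential p q r s c z = (F z).re := by
  obtain ⟨M₁, h₁⟩ := exists_bound_inv_quarticRoot hpq hqr hrs
  obtain ⟨M₂, h₂⟩ := exists_bound_div_quarticRoot_sub hpq hqr hrs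
  refine ⟨fun z => Complex.log (z + Complex.I) -
    Complex.I * rayIntegral (fun w => w * (quarticRoot p q r s w)⁻¹ - (w + Complex.I)⁻¹) z +
    c * (Complex.I * rayIntegral (fun w => (quarticRoot p q r s w)⁻¹) z), fun z hz => ?_,
    fun z hz => ?_⟩
  · have k₁ := hasDerivAt_rayIntegral (differentiableOn_inv_quarticRoot hpq hrs) h₁ hz
    have k₂ := hasDerivAt_rayIntegral (differentiableOn_div_quarticRoot_sub hpq hrs) h₂ hz
    have hslit : z + Complex.I ∈ Complex.slitPlane := by
      refine Complex.mem_slitPlane_iff.2 (Or.inr ?_)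
      simp only [Complex.add_im, Complex.I_im]; linarith
    have k₃ : HasDerivAt (fun z : ℂ => Complex.log (z + Complex.I)) ((z + Complex.I)⁻¹) z := by
      simpa using ((hasDerivAt_id z).add_const Complex.I).clog hslit
    refine ((k₃.sub (k₂.const_mul Complex.I)).add
      ((k₁.const_mul Complex.I).const_mul (c : ℂ))).congr_deriv ?_
    linear_combination (-(z * (quarticRoot p q r s z)⁻¹ - (z + Complex.I)⁻¹) +
      c * (quarticRoot p q r s z)⁻¹) * Complex.I_sq
  · rw [quarticPotential]
    simp [Complex.log_re, sub_eq_add_neg]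

theorem quarticPotential_sub (c : ℝ) (z w : ℂ) :
    quarticPotential p q r s c z - quarticPotential p q r s c w =
      (quarticPotential p q r s 0 z - quarticPotential p q r s 0 w) -
      c * ((rayIntegral (fun w => (quarticRoot p q r s w)⁻¹) z).im -
        (rayIntegral (fun w => (quarticRoot p q r s w)⁻¹) w).im) := by
  simp only [quarticPotential]; ring

theorem continuous_ofReal_upper {u : ℂ → ℝ} (hu : ContinuousOn u {z | 0 ≤ z.im}) :
    Continuous fun t : ℝ => u t :=
  hu.comp_continuous Complex.continuous_ofReal fun t => by simp

/-- The root is real and negative on the gap, so this boundary function has negative derivative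
there. The strict inequality is what makes the equation for `c` solvable. -/
theorem rayIntegral_inv_quarticRoot_lt (hpq : p < q) (hqr : q < r) (hrs : r < s) :
    (rayIntegral (fun w => (quarticRoot p q r s w)⁻¹) r).im <
      (rayIntegral (fun w => (quarticRoot p q r s w)⁻¹) q).im := by
  obtain ⟨M, h⟩ := exists_bound_inv_quarticRoot hpq hqr hrs
  have hd := differentiableOn_inv_quarticRoot hpq hrs
  set u : ℂ → ℝ := fun z => (rayIntegral (fun w => (quarticRoot p q r s w)⁻¹) z).im
  have hu : ContinuousOn u {z | 0 ≤ z.im} :=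
    Complex.continuous_im.comp_continuousOn (continuousOn_rayIntegral hd h)
  have hF : ∀ z : ℂ, 0 < z.im → HasDerivAt
      (fun z => -(Complex.I * rayIntegral (fun w => (quarticRoot p q r s w)⁻¹) z))
      ((quarticRoot p q r s z)⁻¹) z := fun z hz => by
    refine ((hasDerivAt_rayIntegral hd h hz).const_mul Complex.I).neg.congr_deriv ?_
    linear_combination -(quarticRoot p q r s z)⁻¹ * Complex.I_sq
  have hanti : StrictAntiOn (fun t : ℝ => u t) (Icc q r) := by
    refine strictAntiOn_of_deriv_neg (convex_Icc q r)
      (continuous_ofReal_upper hu).continuousOn fun t ht => ?_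
    rw [interior_Icc] at ht
    obtain ⟨x, hx, hxt⟩ := quarticRoot_of_mem_gap hpq hrs ht
    have hn₁ : (t : ℂ) ∉ (fun t : ℝ => (t : ℂ)) '' Icc p q := by
      rintro ⟨y, hy, hyt⟩
      have : y = t := by simpa using hyt
      linarith [hy.2, ht.1]
    have hn₂ : (t : ℂ) ∉ (fun t : ℝ => (t : ℂ)) '' Icc r s := by
      rintro ⟨y, hy, hyt⟩
      have : y = t := by simpa using hyt
      linarith [hy.1, ht.2]
    have hcont : ContinuousAt (fun z => ((quarticRoot p q r s z)⁻¹).re) t :=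
      Complex.continuous_re.continuousAt.comp
        ((differentiableAt_quarticRoot hpq hrs hn₁ hn₂).inv
          (quarticRoot_ne_zero hpq hrs hn₁ hn₂)).continuousAt
    have := hasDerivAt_boundary hu hF (fun z _ => by simp [u])
      (hcont.tendsto.mono_left nhdsWithin_le_nhds)
    rw [this.deriv, hxt, ← Complex.ofReal_inv, Complex.ofReal_re]
    exact inv_lt_zero.2 hx
  exact hanti ⟨le_rfl, hqr.le⟩ ⟨hqr.le, le_rfl⟩ hqr

/-- Where the quartic is negative, the integrand has purely imaginary boundary values, so the
potential has zero derivative along the axis. -/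
theorem quarticPotential_eq_of_mem (hpq : p < q) (hqr : q < r) (hrs : r < s) (c : ℝ) {a b : ℝ}
    (hneg : ∀ t ∈ Ioo a b, (t - p) * (t - q) * (t - r) * (t - s) < 0) {t : ℝ}
    (ht : t ∈ Icc a b) : quarticPotential p q r s c t = quarticPotential p q r s c a := by
  have hu := continuousOn_quarticPotential hpq hqr hrs c
  obtain ⟨F, hF, huF⟩ := exists_hasDerivAt_quarticPotential hpq hqr hrs c
  exact eq_of_hasDerivAt_zero_Ioo (f := fun t : ℝ => quarticPotential p q r s c t)
    (continuous_ofReal_upper hu).continuousOn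
    (fun t ht => hasDerivAt_boundary hu hF huF (tendsto_re_div_quarticRoot c (hneg t ht))) ht

theorem exists_abs_quarticPotential_sub_log_le (hpq : p < q) (hqr : q < r) (hrs : r < s) (c : ℝ) :
    ∃ C, ∀ z : ℂ, 0 ≤ z.im → 1 ≤ ‖z‖ → |quarticPotential p q r s c z - Real.log ‖z‖| ≤ C := by
  obtain ⟨M₁, h₁⟩ := exists_bound_inv_quarticRoot hpq hqr hrs
  obtain ⟨M₂, h₂⟩ := exists_bound_div_quarticRoot_sub hpq hqr hrs
  set C₁ := ∫ s in Ioi (0 : ℝ), M₁ / (√s * (1 + s))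
  set C₂ := ∫ s in Ioi (0 : ℝ), M₂ / (√s * (1 + s))
  refine ⟨Real.log 2 + C₂ + |c| * C₁, fun z hz hz1 => ?_⟩
  have k₁ := (Complex.abs_im_le_norm _).trans (norm_rayIntegral_le h₁ hz)
  have k₂ := (Complex.abs_im_le_norm _).trans (norm_rayIntegral_le h₂ hz)
  have k₃ : |Real.log ‖z + Complex.I‖ - Real.log ‖z‖| ≤ Real.log 2 := by
    have hz0 : 0 < ‖z‖ := by linarith
    have hle : ‖z‖ ≤ ‖z + Complex.I‖ := by
      rw [← sq_le_sq₀ (norm_nonneg _) (norm_nonneg _), ← Complex.normSq_eq_norm_sq,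
        ← Complex.normSq_eq_norm_sq, Complex.normSq_apply, Complex.normSq_apply]
      simp only [Complex.add_re, Complex.add_im, Complex.I_re, Complex.I_im]
      nlinarith
    have hle2 : ‖z + Complex.I‖ ≤ 2 * ‖z‖ := by
      refine (norm_add_le _ _).trans ?_
      rw [Complex.norm_I]; linarith
    have l1 := Real.log_le_log hz0 hle
    have l2 := Real.log_le_log (hz0.trans_le hle) hle2
    rw [Real.log_mul two_ne_zero hz0.ne'] at l2
    rw [abs_of_nonneg (by linarith)]
    linarith
  have k₄ := mul_le_mul_of_nonneg_left k₁ (abs_nonneg c)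
  rw [← abs_mul] at k₄
  rw [quarticPotential, abs_le]
  rw [abs_le] at k₂ k₃ k₄
  constructor <;> linarith [k₂.1, k₂.2, k₃.1, k₃.2, k₄.1, k₄.2]

open ComplexConjugate in
/-- The complement of the union of two disjoint real intervals has a Green function. -/
theorem exists_isGreenInfty_two (hpq : p < q) (hqr : q < r) (hrs : r < s) :
    ∃ g, IsGreenInfty
      ((fun t : ℝ => (t : ℂ)) '' Icc p q ∪ (fun t : ℝ => (t : ℂ)) '' Icc r s) g := by
  have hlt := rayIntegral_inv_quarticRoot_lt hpq hqr hrs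
  -- The difference of the potential across the gap is affine in `c` with nonzero slope.
  obtain ⟨c, hc⟩ : ∃ c, quarticPotential p q r s c r = quarticPotential p q r s c q := by
    refine ⟨(quarticPotential p q r s 0 r - quarticPotential p q r s 0 q) /
      ((rayIntegral (fun w => (quarticRoot p q r s w)⁻¹) r).im -
        (rayIntegral (fun w => (quarticRoot p q r s w)⁻¹) q).im), ?_⟩
    rw [← sub_eq_zero, quarticPotential_sub, div_mul_cancel₀ _ (sub_neg.2 hlt).ne, sub_self]
  set u := quarticPotential p q r s c
  have hu : ContinuousOn u {z | 0 ≤ z.im} := continuousOn_quarticPotential hpq hqr hrs c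
  obtain ⟨F, hF, huF⟩ := exists_hasDerivAt_quarticPotential hpq hqr hrs c
  have e₁ : ∀ t ∈ Icc p q, u t = u p := fun t ht =>
    quarticPotential_eq_of_mem hpq hqr hrs c (fun t ht => by
      have h1 : (t - p) * (t - q) < 0 :=
        mul_neg_of_pos_of_neg (by linarith [ht.1]) (by linarith [ht.2])
      have h2 : 0 < (t - r) * (t - s) :=
        mul_pos_of_neg_of_neg (by linarith [ht.2]) (by linarith [ht.2])
      rw [mul_assoc]
      exact mul_neg_of_neg_of_pos h1 h2) ht
  have e₂ : ∀ t ∈ Icc r s, u t = u p := fun t ht => by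
    rw [← e₁ q ⟨hpq.le, le_rfl⟩, ← hc]
    exact quarticPotential_eq_of_mem hpq hqr hrs c (fun t ht => by
      have h1 : 0 < (t - p) * (t - q) := mul_pos (by linarith [ht.1]) (by linarith [ht.1])
      have h2 : (t - r) * (t - s) < 0 :=
        mul_neg_of_pos_of_neg (by linarith [ht.1]) (by linarith [ht.2])
      rw [mul_assoc]
      exact mul_neg_of_pos_of_neg h1 h2) ht
  have hclosed : IsClosed
      ((fun t : ℝ => (t : ℂ)) '' Icc p q ∪ (fun t : ℝ => (t : ℂ)) '' Icc r s) :=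
    ((isCompact_Icc.image Complex.continuous_ofReal).union
      (isCompact_Icc.image Complex.continuous_ofReal)).isClosed
  have him : ∀ z : ℂ, (0 : ℝ) ≤ (z.re + |z.im| * Complex.I : ℂ).im := fun z => by simp
  refine ⟨fun z => u (z.re + |z.im| * Complex.I) - u p, ?_, ?_, ?_, ?_⟩
  · have hf : DifferentiableOn ℂ (fun z => (z - c) * (quarticRoot p q r s z)⁻¹)
        ((fun t : ℝ => (t : ℂ)) '' Icc p q ∪ (fun t : ℝ => (t : ℂ)) '' Icc r s)ᶜ := by
      intro z hz
      rw [compl_union] at hz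
      have h1 := (differentiableAt_quarticRoot hpq hrs hz.1 hz.2).inv
        (quarticRoot_ne_zero hpq hrs hz.1 hz.2)
      exact ((differentiableAt_id.sub_const (c : ℂ)).mul h1).differentiableWithinAt
    refine (harmonicOnNhd_reflect hclosed hu hF huF hf fun z hz => ?_).sub
      (harmonicOnNhd_const (u p))
    rw [mem_union, not_or] at hz
    simp [quarticRoot_conj hpq hrs hz.1 hz.2]
  · refine (hu.comp_continuous ?_ him).sub continuous_const
    have := Complex.continuous_ofReal.comp Complex.continuous_re
    have := Complex.continuous_ofReal.comp Complex.continuous_im.abs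
    fun_prop
  · rintro _ (⟨t, ht, rfl⟩ | ⟨t, ht, rfl⟩)
    · simp [e₁ t ht]
    · simp [e₂ t ht]
  · obtain ⟨C, hC⟩ := exists_abs_quarticPotential_sub_log_le hpq hqr hrs c
    refine Asymptotics.IsBigO.of_bound (C + |u p|) ?_
    filter_upwards [tendsto_norm_cocompact_atTop.eventually_ge_atTop 1] with z hz
    have hn : ‖(z.re + |z.im| * Complex.I : ℂ)‖ = ‖z‖ := by
      rw [← sq_eq_sq₀ (norm_nonneg _) (norm_nonneg _), ← Complex.normSq_eq_norm_sq,
        ← Complex.normSq_eq_norm_sq, Complex.normSq_apply, Complex.normSq_apply]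
      simp
    have h := hC _ (him z) (hn ▸ hz)
    rw [hn] at h
    rw [norm_one, mul_one, Real.norm_eq_abs]
    rw [abs_le] at h ⊢
    constructor <;> linarith [h.1, h.2, le_abs_self (u p), neg_abs_le (u p)]

end TwoIntervalGreen

/-! ### The symmetric set and the comparison at the origin -/

theorem IsGreenInfty.greenInfty {E : Set ℂ} {g : ℂ → ℝ} (hg : IsGreenInfty E g) :
    IsGreenInfty E (greenInfty E) := by
  have hex : ∃ g, IsGreenInfty E g := ⟨g, hg⟩
  rw [_root_.greenInfty, dif_pos hex]
  exact hex.choose_spec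

theorem intervalGreen_of_le_left {a b t : ℝ} (hab : a < b) (ht : t ≤ a) :
    intervalGreen a b t = Real.arcosh ((a + b - 2 * t) / (b - a)) := by
  rw [intervalGreen, ← Complex.ofReal_sub, ← Complex.ofReal_sub, Complex.norm_real,
    Complex.norm_real, Real.norm_of_nonpos (by linarith), Real.norm_of_nonpos (by linarith)]
  congr 2; ring

theorem intervalGreen_of_right_le {a b t : ℝ} (hab : a < b) (ht : b ≤ t) :
    intervalGreen a b t = Real.arcosh ((2 * t - a - b) / (b - a)) := by
  rw [intervalGreen, ← Complex.ofReal_sub, ← Complex.ofReal_sub, Complex.norm_real,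
    Complex.norm_real, Real.norm_of_nonneg (by linarith), Real.norm_of_nonneg (by linarith)]
  congr 2; ring

theorem greenOne_eq {δ : ℝ} (hδ : δ < 1) (x : ℝ) : greenOne δ x = intervalGreen (-1 + 2 * δ) 1 x := by
  have h : -1 + 2 * δ < 1 := by linarith
  rw [greenOne, (isGreenInfty_intervalGreen h).greenInfty_eq h Subset.rfl (E := oneInterval δ)]

theorem sq_mem_ofReal_image_iff {δ : ℝ} (hδ : 0 < δ) (z : ℂ) :
    z ^ 2 ∈ (fun t : ℝ => (t : ℂ)) '' Icc (δ ^ 2) 1 ↔ z ∈ twoIntervals 0 δ := by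
  constructor
  · rintro ⟨x, ⟨hx1, hx2⟩, hx⟩
    have hx0 : 0 ≤ x := (sq_nonneg δ).trans hx1
    have h1 : δ ≤ √x := Real.le_sqrt_of_sq_le hx1
    have h2 : √x ≤ 1 := Real.sqrt_le_one.2 hx2
    have h3 : z ^ 2 = ((√x : ℝ) : ℂ) ^ 2 := by
      rw [← Complex.ofReal_pow, Real.sq_sqrt hx0]; exact hx.symm
    rcases sq_eq_sq_iff_eq_or_eq_neg.1 h3 with h | h
    · exact ⟨√x, ⟨⟨by linarith, h2⟩, fun h4 => by linarith [h4.2]⟩, h.symm⟩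
    · exact ⟨-√x, ⟨⟨by linarith, by linarith⟩, fun h4 => by linarith [h4.1]⟩, by simp [h]⟩
  · rintro ⟨t, ⟨⟨ht1, ht2⟩, ht⟩, rfl⟩
    refine ⟨t ^ 2, ⟨?_, ?_⟩, by simp⟩
    · rw [mem_Ioo, not_and_or, not_lt, not_lt] at ht
      rcases ht with h | h <;> nlinarith
    · nlinarith

/-- `E(0, δ)` is the preimage of `[δ ^ 2, 1]` under squaring; the factor `1 / 2` compensates `log |z
^ 2| = 2 log |z|`. -/
theorem isGreenInfty_twoIntervals_zero {δ : ℝ} (hδ : 0 < δ) (hδ1 : δ < 1) :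
    IsGreenInfty (twoIntervals 0 δ) (fun z => 1 / 2 * intervalGreen (δ ^ 2) 1 (z ^ 2)) := by
  have h1 : δ ^ 2 < 1 := by nlinarith
  refine ⟨fun z hz => ?_, ?_, fun z hz => ?_, ?_⟩
  · have h2 := harmonicOnNhd_intervalGreen h1 (z ^ 2)
      (fun h => hz ((sq_mem_ofReal_image_iff hδ z).1 h))
    exact (h2.comp_analyticAt (φ := fun z => z ^ 2) (by fun_prop)).const_smul (c := (1 / 2 : ℝ))
  · exact continuous_const.mul ((continuous_intervalGreen h1).comp (by fun_prop))
  · have h2 := (isGreenInfty_intervalGreen h1).eq_zero _ ((sq_mem_ofReal_image_iff hδ z).2 hz)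
    rw [h2, mul_zero]
  · have h2 : Tendsto (fun z : ℂ => z ^ 2) (cocompact ℂ) (cocompact ℂ) := by
      rw [← Metric.cobounded_eq_cocompact, ← tendsto_norm_atTop_iff_cobounded]
      simp only [norm_pow]
      exact (tendsto_pow_atTop two_ne_zero).comp tendsto_norm_cobounded_atTop
    refine (((intervalGreen_sub_log_isBigO h1).comp_tendsto h2).const_mul_left (1 / 2)).congr_left
      fun z => ?_
    simp only [Function.comp, norm_pow, Real.log_pow]
    push_cast; ring

theorem greenTwo_zero_zero {δ : ℝ} (hδ : 0 < δ) (hδ1 : δ < 1) :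
    greenTwo 0 δ 0 = 1 / 2 * Real.arcosh ((1 + δ ^ 2) / (1 - δ ^ 2)) := by
  have h1 : δ ^ 2 < 1 := by nlinarith
  have hsub : (fun t : ℝ => (t : ℂ)) '' Icc δ 1 ⊆ twoIntervals 0 δ := by
    rintro _ ⟨t, ⟨ht1, ht2⟩, rfl⟩
    exact ⟨t, ⟨⟨by linarith, ht2⟩, fun h => by linarith [h.2]⟩, rfl⟩
  rw [greenTwo, (isGreenInfty_twoIntervals_zero hδ hδ1).greenInfty_eq hδ1 hsub]
  have h2 := intervalGreen_of_le_left (t := 0) h1 (sq_nonneg δ)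
  simp only [← Complex.ofReal_pow, zero_pow two_ne_zero, h2]
  congr 3; ring

theorem two_mul_arcosh {s : ℝ} (hs : 1 ≤ s) :
    2 * Real.arcosh s = Real.arcosh (2 * s ^ 2 - 1) := by
  rw [← Real.arcosh_cosh (x := 2 * Real.arcosh s) (by linarith [Real.arcosh_nonneg hs]),
    Real.cosh_two_mul, Real.sinh_sq, Real.cosh_arcosh hs]
  congr 1; ring

/-- For `δ ≤ 1/2` the origin lies in `E(δ)` and the left side vanishes. Otherwise, after doubling
both sides, the claim becomes `(δ / (1 - δ)) ^ 2 < 1 / (1 - δ ^ 2)`, which is the hypothesis cleared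
of denominators. -/
theorem greenOne_zero_lt_greenTwo_zero {δ : ℝ} (hδ : 0 < δ) (hδ1 : δ < 1)
    (h : δ ^ 2 * (1 + δ) < 1 - δ) : greenOne δ 0 < greenTwo 0 δ 0 := by
  have h1 : 0 < 1 - δ ^ 2 := by nlinarith
  have h0 : 1 < (1 + δ ^ 2) / (1 - δ ^ 2) := by
    rw [one_lt_div h1]; nlinarith [sq_pos_of_pos hδ]
  rw [greenTwo_zero_zero hδ hδ1, greenOne_eq hδ1]
  have hab : -1 + 2 * δ < 1 := by linarith
  rcases le_total (-1 + 2 * δ) 0 with h2 | h2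
  · rw [intervalGreen_of_mem hab ⟨h2, zero_le_one⟩]
    have := Real.arcosh_pos h0
    linarith
  · rw [intervalGreen_of_le_left hab h2]
    have e : (-1 + 2 * δ + 1 - 2 * 0) / (1 - (-1 + 2 * δ)) = δ / (1 - δ) := by
      rw [div_eq_div_iff (by linarith) (by linarith)]; ring
    have hd : 0 < 1 - δ := by linarith
    have h3 : 1 ≤ δ / (1 - δ) := by rw [one_le_div hd]; linarith
    have h4 : 2 * (δ / (1 - δ)) ^ 2 - 1 < (1 + δ ^ 2) / (1 - δ ^ 2) := by
      have h5 : (δ / (1 - δ)) ^ 2 < 1 / (1 - δ ^ 2) := by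
        rw [div_pow, div_lt_div_iff₀ (by positivity) h1]
        nlinarith
      have h6 : (1 + δ ^ 2) / (1 - δ ^ 2) = 2 * (1 / (1 - δ ^ 2)) - 1 := by
        field_simp; ring
      linarith
    rw [e]
    have h7 : 0 < 2 * (δ / (1 - δ)) ^ 2 - 1 := by nlinarith
    have h8 := (Real.arcosh_lt_arcosh h7 (by linarith)).2 h4
    rw [← two_mul_arcosh h3] at h8
    linarith

/-! ### Bounds when the left interval has length `ε` -/

theorem exists_isGreenInfty_nested {δ ε : ℝ} (hδ : 0 < δ) (hε : 0 < ε) (hε1 : ε ≤ 1 - δ) :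
    twoIntervals (δ - 1 + ε) δ = (fun t : ℝ => (t : ℂ)) '' Icc (-1) (-1 + ε) ∪
      (fun t : ℝ => (t : ℂ)) '' Icc (-1 + 2 * δ + ε) 1 ∧
    IsGreenInfty (twoIntervals (δ - 1 + ε) δ) (greenInfty (twoIntervals (δ - 1 + ε) δ)) := by
  have hset : twoIntervals (δ - 1 + ε) δ = (fun t : ℝ => (t : ℂ)) '' Icc (-1) (-1 + ε) ∪
      (fun t : ℝ => (t : ℂ)) '' Icc (-1 + 2 * δ + ε) 1 := by
    rw [twoIntervals, ← image_union]
    congr 1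
    ext t
    simp only [Set.mem_sdiff, mem_union, mem_Icc, mem_Ioo, not_and_or, not_lt]
    constructor
    · rintro ⟨⟨h1, h2⟩, h | h⟩
      · exact Or.inl ⟨h1, by linarith⟩
      · exact Or.inr ⟨by linarith, h2⟩
    · rintro (⟨h1, h2⟩ | ⟨h1, h2⟩)
      · exact ⟨⟨h1, by linarith⟩, Or.inl (by linarith)⟩
      · exact ⟨⟨by linarith, h2⟩, Or.inr (by linarith)⟩
  refine ⟨hset, ?_⟩
  obtain ⟨g, hg⟩ := exists_isGreenInfty_two (p := -1) (q := -1 + ε) (r := -1 + 2 * δ + ε) (s := 1)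
    (by linarith) (by linarith) (by linarith)
  rw [← hset] at hg
  exact hg.greenInfty

theorem log_two_add_arcosh_le {s₁ s₂ : ℝ} (h₁ : 1 ≤ s₁) (h : 2 * s₁ ≤ s₂) :
    Real.log 2 + Real.arcosh s₁ ≤ Real.arcosh s₂ := by
  have h0 := Real.sqrt_nonneg (s₁ ^ 2 - 1)
  rw [Real.arcosh, Real.arcosh, ← Real.log_mul two_ne_zero (by positivity)]
  refine Real.log_le_log (by positivity) ?_
  have : 2 * √(s₁ ^ 2 - 1) ≤ √(s₂ ^ 2 - 1) := by
    refine Real.le_sqrt_of_sq_le ?_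
    rw [mul_pow, Real.sq_sqrt (by nlinarith)]
    nlinarith
  linarith

/-- With `y = arcosh s₁` and increment `h`, the addition formula gives `cosh (y + h) ≥ cosh y + y
h`. It bounds the effect of moving the long interval by `ε`. -/
theorem arcosh_sub_arcosh_mul_le {s₁ s₂ : ℝ} (h₁ : 1 ≤ s₁) (h : s₁ ≤ s₂) :
    (Real.arcosh s₂ - Real.arcosh s₁) * Real.arcosh s₁ ≤ s₂ - s₁ := by
  have hy := Real.arcosh_nonneg h₁
  have hh : 0 ≤ Real.arcosh s₂ - Real.arcosh s₁ :=
    sub_nonneg.2 ((Real.arcosh_le_arcosh (by linarith) (by linarith)).2 h)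
  have h2 := Real.cosh_add (Real.arcosh s₁) (Real.arcosh s₂ - Real.arcosh s₁)
  rw [add_sub_cancel, Real.cosh_arcosh (h₁.trans h), Real.cosh_arcosh h₁] at h2
  have h3 := Real.one_le_cosh (Real.arcosh s₂ - Real.arcosh s₁)
  have h4 := Real.self_le_sinh_iff.2 hh
  have h5 := Real.self_le_sinh_iff.2 hy
  have h6 := mul_le_mul h5 h4 hh (hy.trans h5)
  nlinarith

theorem greenOne_nonneg {δ : ℝ} (hδ1 : δ < 1) (x : ℝ) : 0 ≤ greenOne δ x := by
  rw [greenOne_eq hδ1]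
  exact intervalGreen_nonneg (by linarith) _

/-- Here `A` is the minimum of `g_J` on `I`, `m` bounds `g_I` on `J` from below, and `κ = m / (A +
m)` solves `κ A = (1 - κ) m`. Since `x` is at most half as far from `-1` as the end `-1 + 2δ`, the
value `g_J(x)` is smaller than `A` by at least `log 2`. -/
theorem greenTwo_le_greenOne_add {δ ε x m : ℝ} (hδ : 0 < δ) (hδ1 : δ < 1) (hε : 0 < ε)
    (hε1 : ε ≤ 1 - δ) (hm : m = Real.arcosh (1 / (1 - δ))) (hx : -1 + ε < x) (hx1 : x ≤ -1 + δ) :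
    greenTwo (δ - 1 + ε) δ x ≤ greenOne δ x + 2 * ε / ((1 - δ) ^ 2 * m) -
      m / (Real.log (10 / ε) + m) * Real.log 2 := by
  obtain ⟨hset, hg⟩ := exists_isGreenInfty_nested hδ hε hε1
  have hd : 0 < 1 - δ := by linarith
  have hs1 : 1 < 1 / (1 - δ) := by rw [one_lt_div hd]; linarith
  have hm0 : 0 < m := hm ▸ Real.arcosh_pos hs1
  have hpq : (-1 : ℝ) < -1 + ε := by linarith
  have hrs : -1 + 2 * δ + ε < 1 := by linarith
  have hA0 : 0 ≤ intervalGreen (-1) (-1 + ε) (-1 + 2 * δ + ε : ℝ) := intervalGreen_nonneg hpq _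
  have hAeq : intervalGreen (-1) (-1 + ε) (-1 + 2 * δ + ε : ℝ) = Real.arcosh ((4 * δ + ε) / ε) := by
    rw [intervalGreen_of_right_le hpq (by linarith)]
    congr 2 <;> ring
  set A := intervalGreen (-1) (-1 + ε) (-1 + 2 * δ + ε : ℝ)
  have hAm : 0 < A + m := by linarith
  have hκ : 0 < m / (A + m) := by positivity
  have hκ1 : 1 - m / (A + m) = A / (A + m) := by field_simp; ring
  have hcmp := hg.le_combination hpq hrs hset (κ := m / (A + m)) (A := A) hκ.le ?_ ?_ x
  · have hGA : intervalGreen (-1) (-1 + ε) x + Real.log 2 ≤ A := by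
      rw [intervalGreen_of_right_le hpq hx.le, hAeq, add_comm]
      have hsub : -1 + ε - -1 = ε := by ring
      rw [hsub]
      refine log_two_add_arcosh_le ?_ ?_
      · rw [one_le_div hε]; linarith
      · rw [← mul_div_assoc]
        refine div_le_div_of_nonneg_right ?_ hε.le
        linarith
    have hGI : intervalGreen (-1 + 2 * δ + ε) 1 x ≤ greenOne δ x + 2 * ε / ((1 - δ) ^ 2 * m) := by
      rw [greenOne_eq hδ1, intervalGreen_of_le_left hrs (by linarith),
        intervalGreen_of_le_left (by linarith : -1 + 2 * δ < 1) (by linarith)]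
      set s₁ := (-1 + 2 * δ + 1 - 2 * x) / (1 - (-1 + 2 * δ)) with hs₁
      set s₂ := (-1 + 2 * δ + ε + 1 - 2 * x) / (1 - (-1 + 2 * δ + ε)) with hs₂
      have hs₁1 : 1 / (1 - δ) ≤ s₁ := by
        rw [hs₁, div_le_div_iff₀ hd (by linarith)]
        nlinarith
      have hdiff : s₂ - s₁ = ε * (2 - 2 * x) / ((2 - 2 * δ - ε) * (2 - 2 * δ)) := by
        have e1 : 2 - 2 * δ - ε ≠ 0 := by linarith
        have e2 : 2 - 2 * δ ≠ 0 := by linarith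
        rw [hs₁, hs₂, show 1 - (-1 + 2 * δ) = 2 - 2 * δ by ring,
          show 1 - (-1 + 2 * δ + ε) = 2 - 2 * δ - ε by ring, div_sub_div _ _ e1 e2]
        congr 1; ring
      have hdiff1 : s₂ - s₁ ≤ 2 * ε / (1 - δ) ^ 2 := by
        have e3 : 0 < 2 - 2 * δ - ε := by linarith
        rw [hdiff, div_le_div_iff₀ (mul_pos e3 (by linarith)) (by positivity)]
        have e4 : 2 - 2 * x ≤ 4 := by linarith
        have e5 : (1 - δ) * (1 - δ) ≤ (2 - 2 * δ - ε) * (1 - δ) := by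
          apply mul_le_mul_of_nonneg_right _ hd.le; linarith
        calc ε * (2 - 2 * x) * (1 - δ) ^ 2 ≤ ε * 4 * ((2 - 2 * δ - ε) * (1 - δ)) := by
              rw [sq]; gcongr
          _ = _ := by ring
      have hdiff0 : s₁ ≤ s₂ := by
        rw [← sub_nonneg, hdiff]
        have e3 : 0 < 2 - 2 * δ - ε := by linarith
        exact div_nonneg (mul_nonneg hε.le (by linarith)) (mul_nonneg e3.le (by linarith))
      have hle := arcosh_sub_arcosh_mul_le (hs1.le.trans hs₁1) hdiff0
      have hms : m ≤ Real.arcosh s₁ :=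
        hm ▸ (Real.arcosh_le_arcosh (by linarith) (by linarith)).2 hs₁1
      have hh : 0 ≤ Real.arcosh s₂ - Real.arcosh s₁ :=
        sub_nonneg.2 ((Real.arcosh_le_arcosh (by linarith) (by linarith)).2 hdiff0)
      have h1 : (Real.arcosh s₂ - Real.arcosh s₁) * m ≤ 2 * ε / (1 - δ) ^ 2 :=
        (mul_le_mul_of_nonneg_left hms hh).trans (hle.trans hdiff1)
      rw [← div_div, ← sub_le_iff_le_add', le_div_iff₀ hm0]
      exact h1
    have hAle : A ≤ Real.log (10 / ε) := by
      have h1 : 1 ≤ (4 * δ + ε) / ε := by rw [one_le_div hε]; linarith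
      rw [hAeq]
      refine (arcosh_le_log_two_mul h1).trans (Real.log_le_log (by linarith) ?_)
      rw [← mul_div_assoc]
      refine div_le_div_of_nonneg_right ?_ hε.le
      linarith
    have hlog2 : 0 < Real.log 2 := Real.log_pos one_lt_two
    have hκ2 : m / (Real.log (10 / ε) + m) ≤ m / (A + m) := by gcongr
    have h3 := mul_le_mul_of_nonneg_right hκ2 hlog2.le
    have h4 := mul_le_mul_of_nonneg_left hGA hκ.le
    have h5 := mul_nonneg hκ.le (intervalGreen_nonneg hrs x)
    rw [greenTwo]
    linarith
  · intro t ht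
    rw [hκ1, intervalGreen_of_le_left hrs (by linarith [ht.2])]
    have : m ≤ Real.arcosh ((-1 + 2 * δ + ε + 1 - 2 * t) / (1 - (-1 + 2 * δ + ε))) := by
      rw [hm]
      have h1 : 1 / (1 - δ) ≤ (-1 + 2 * δ + ε + 1 - 2 * t) / (1 - (-1 + 2 * δ + ε)) := by
        rw [div_le_div_iff₀ hd (by linarith)]
        nlinarith [ht.2]
      exact (Real.arcosh_le_arcosh (by linarith) (by linarith)).2 h1
    calc m / (A + m) * A = A / (A + m) * m := by ring
      _ ≤ _ := by gcongr
  · intro t ht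
    rw [hAeq, intervalGreen_of_right_le hpq (by linarith [ht.1]),
      show -1 + ε - -1 = ε by ring]
    have h1 : (4 * δ + ε) / ε ≤ (2 * t - -1 - (-1 + ε)) / ε :=
      div_le_div_of_nonneg_right (by linarith [ht.1]) hε.le
    have h2 : 0 < (4 * δ + ε) / ε := by positivity
    exact (Real.arcosh_le_arcosh h2 (h2.trans_le h1)).2 h1

/-- The same balance with the bounds reversed: `A` is the maximum of `g_J` on `I`, and `m` bounds
`g_I` on `J` from above, uniformly in `ε`. -/
theorem le_greenTwo {δ ε x m : ℝ} (hδ : 0 < δ) (hδ1 : δ < 1) (hε : 0 < ε) (hε1 : ε ≤ 1 - δ)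
    (hm : m = Real.arcosh ((3 + 2 * δ) / (1 - δ))) (hx : -1 + ε < x) (hx1 : x ≤ -1 + δ) :
    greenOne δ x - m / (Real.log (1 / ε) + m) * (greenOne δ x + Real.log (8 / (x + 1))) ≤
      greenTwo (δ - 1 + ε) δ x := by
  obtain ⟨hset, hg⟩ := exists_isGreenInfty_nested hδ hε hε1
  have hd : 0 < 1 - δ := by linarith
  have hs1 : 1 < (3 + 2 * δ) / (1 - δ) := by rw [one_lt_div hd]; linarith
  have hm0 : 0 < m := hm ▸ Real.arcosh_pos hs1
  have hpq : (-1 : ℝ) < -1 + ε := by linarith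
  have hrs : -1 + 2 * δ + ε < 1 := by linarith
  have hA0 : 0 ≤ intervalGreen (-1) (-1 + ε) (1 : ℝ) := intervalGreen_nonneg hpq _
  have hAeq : intervalGreen (-1) (-1 + ε) (1 : ℝ) = Real.arcosh ((4 - ε) / ε) := by
    rw [intervalGreen_of_right_le hpq (by linarith)]
    congr 2 <;> ring
  set A := intervalGreen (-1) (-1 + ε) (1 : ℝ)
  have hAm : 0 < A + m := by linarith
  have hκ : 0 < m / (A + m) := by positivity
  have hκ1 : 1 - m / (A + m) = A / (A + m) := by field_simp; ring
  have hcmp := hg.combination_le hpq hrs hset (κ := m / (A + m)) (A := A) hκ.le ?_ ?_ x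
  · have hGI : greenOne δ x ≤ intervalGreen (-1 + 2 * δ + ε) 1 x := by
      rw [greenOne_eq hδ1, intervalGreen_of_le_left hrs (by linarith),
        intervalGreen_of_le_left (by linarith : -1 + 2 * δ < 1) (by linarith)]
      have h1 : (-1 + 2 * δ + 1 - 2 * x) / (1 - (-1 + 2 * δ)) ≤
          (-1 + 2 * δ + ε + 1 - 2 * x) / (1 - (-1 + 2 * δ + ε)) :=
        div_le_div₀ (by linarith) (by linarith) (by linarith) (by linarith)
      have h2 : 0 < (-1 + 2 * δ + 1 - 2 * x) / (1 - (-1 + 2 * δ)) :=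
        div_pos (by linarith) (by linarith)
      exact (Real.arcosh_le_arcosh h2 (h2.trans_le h1)).2 h1
    have hx0 : 0 < x + 1 := by linarith
    have h4 : 1 ≤ (4 - ε) / ε := by rw [one_le_div hε]; linarith
    have hGA : A - Real.log (8 / (x + 1)) ≤ intervalGreen (-1) (-1 + ε) x := by
      rw [intervalGreen_of_right_le hpq hx.le, hAeq, show -1 + ε - -1 = ε by ring]
      have h5 : (x + 1) / ε ≤ (2 * x - -1 - (-1 + ε)) / ε :=
        div_le_div_of_nonneg_right (by linarith) hε.le
      have h6 : 1 ≤ (2 * x - -1 - (-1 + ε)) / ε := by rw [one_le_div hε]; linarith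
      have h7 := log_le_arcosh h6
      have h8 := Real.log_le_log (by positivity) h5
      have h9 : Real.arcosh ((4 - ε) / ε) ≤ Real.log (8 / ε) := by
        refine (arcosh_le_log_two_mul h4).trans (Real.log_le_log (by linarith) ?_)
        rw [← mul_div_assoc]
        exact div_le_div_of_nonneg_right (by linarith) hε.le
      rw [Real.log_div (by norm_num) hε.ne'] at h9
      rw [Real.log_div hx0.ne' hε.ne'] at h8
      rw [Real.log_div (by norm_num) hx0.ne']
      linarith
    have hAge : Real.log (1 / ε) ≤ A := by
      rw [hAeq]
      refine le_trans (Real.log_le_log (by positivity) ?_) (log_le_arcosh h4)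
      exact div_le_div_of_nonneg_right (by linarith) hε.le
    have hlogε : 0 ≤ Real.log (1 / ε) := Real.log_nonneg (by rw [one_le_div hε]; linarith)
    have hlog8 : 0 ≤ Real.log (8 / (x + 1)) :=
      Real.log_nonneg (by rw [one_le_div hx0]; linarith)
    have hκ2 : m / (A + m) ≤ m / (Real.log (1 / ε) + m) := by gcongr
    have h5 := mul_le_mul_of_nonneg_right hκ2 (add_nonneg (greenOne_nonneg hδ1 x) hlog8)
    have h6 := mul_le_mul_of_nonneg_left hGA hκ.le
    have h7 : (1 - m / (A + m)) * greenOne δ x ≤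
        (1 - m / (A + m)) * intervalGreen (-1 + 2 * δ + ε) 1 x := by
      rw [hκ1]; gcongr
    rw [greenTwo]
    linarith
  · intro t ht
    rw [hκ1, intervalGreen_of_le_left hrs (by linarith [ht.2])]
    have : Real.arcosh ((-1 + 2 * δ + ε + 1 - 2 * t) / (1 - (-1 + 2 * δ + ε))) ≤ m := by
      rw [hm]
      have h1 : (-1 + 2 * δ + ε + 1 - 2 * t) / (1 - (-1 + 2 * δ + ε)) ≤ (3 + 2 * δ) / (1 - δ) :=
        div_le_div₀ (by linarith) (by linarith [ht.1]) hd (by linarith)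
      refine (Real.arcosh_le_arcosh (div_pos ?_ ?_) (by linarith)).2 h1 <;> linarith [ht.2]
    calc A / (A + m) * _ ≤ A / (A + m) * m := by gcongr
      _ = _ := by ring
  · intro t ht
    rw [hAeq, intervalGreen_of_right_le hpq (by linarith [ht.1]),
      show -1 + ε - -1 = ε by ring]
    have h1 : (2 * t - -1 - (-1 + ε)) / ε ≤ (4 - ε) / ε :=
      div_le_div_of_nonneg_right (by linarith [ht.2]) hε.le
    have h2 : 0 < (2 * t - -1 - (-1 + ε)) / ε := div_pos (by linarith [ht.1]) hε
    exact (Real.arcosh_le_arcosh h2 (h2.trans_le h1)).2 h1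

theorem greenTwo_eq_zero_of_le {α δ x : ℝ} (hδ : 0 < δ) (hδ1 : δ < 1) (hα : α ∈ Ioc (δ - 1) 0)
    (hx : -1 < x) (hxα : x ≤ α - δ) : greenTwo α δ x = 0 := by
  obtain ⟨-, hg⟩ := exists_isGreenInfty_nested hδ (ε := α - (δ - 1)) (by linarith [hα.1])
    (by linarith [hα.2])
  rw [add_sub_cancel] at hg
  exact hg.eq_zero _ ⟨x, ⟨⟨hx.le, by linarith [hα.2]⟩, fun h => by linarith [h.1]⟩, rfl⟩

/-! ### The envelope near the left end point -/

theorem tendsto_mul_log_div_add (C m : ℝ) :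
    Tendsto (fun ε : ℝ => C * ε * (Real.log (10 / ε) + m)) (𝓝[>] 0) (𝓝 0) := by
  have h1 : Tendsto (fun ε : ℝ => Real.log ε * ε) (𝓝[>] 0) (𝓝 0) := by
    simpa using tendsto_log_mul_rpow_nhdsGT_zero zero_lt_one
  have h2 : Tendsto (fun ε : ℝ => ε) (𝓝[>] 0) (𝓝 0) := tendsto_id.mono_left nhdsWithin_le_nhds
  have h3 := ((h2.mul_const (Real.log 10 + m)).sub h1).const_mul C
  simp only [zero_mul, sub_zero, mul_zero] at h3
  refine h3.congr' ?_
  filter_upwards [self_mem_nhdsWithin] with ε hε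
  have hε' : (0 : ℝ) < ε := hε
  rw [Real.log_div (by norm_num) hε'.ne']
  ring

theorem exists_upperEnvelope_le_greenOne {δ : ℝ} (hδ : 0 < δ) (hδ1 : δ < 1) :
    ∃ η > 0, ∀ x ∈ Ioo (-1) (-1 + η), upperEnvelope δ x ≤ (greenOne δ x : EReal) := by
  set m := Real.arcosh (1 / (1 - δ)) with hm
  have hd : 0 < 1 - δ := by linarith
  have hm0 : 0 < m := Real.arcosh_pos (by rw [one_lt_div hd]; linarith)
  have hlog2 : 0 < Real.log 2 := Real.log_pos one_lt_two
  -- Because `ε log (1/ε) → 0`, the gain of order `ε` falls below the loss of order `1 / log (1/ε)`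
  -- for all small `ε`.
  have hev := (tendsto_mul_log_div_add (2 / ((1 - δ) ^ 2 * m)) m).eventually
    (gt_mem_nhds (mul_pos hm0 hlog2))
  obtain ⟨η₀, hη₀, hsub⟩ := mem_nhdsGT_iff_exists_Ioo_subset.1 hev
  have hη₀' : 0 < η₀ := hη₀
  refine ⟨min η₀ δ, lt_min hη₀' hδ, fun x hx => iSup₂_le fun α hα => ?_⟩
  rw [EReal.coe_le_coe_iff]
  -- Either `x` lies in the short interval, where the Green function vanishes, or `ε < x + 1`, so
  -- that closeness of `x` to `-1` forces `ε` to be small.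
  rcases le_or_gt x (α - δ) with h | h
  · rw [greenTwo_eq_zero_of_le hδ hδ1 hα hx.1 h]
    exact greenOne_nonneg hδ1 x
  · set ε := α - (δ - 1) with hε
    have hxη : x < -1 + η₀ := hx.2.trans_le (by linarith [min_le_left η₀ δ])
    have hxδ : x < -1 + δ := hx.2.trans_le (by linarith [min_le_right η₀ δ])
    have hε0 : 0 < ε := by linarith [hα.1]
    have hε1 : ε ≤ 1 - δ := by linarith [hα.2]
    have h1 := greenTwo_le_greenOne_add hδ hδ1 hε0 hε1 hm (x := x) (by linarith) hxδ.le
    rw [show δ - 1 + ε = α by ring] at h1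
    have h2 : 2 / ((1 - δ) ^ 2 * m) * ε * (Real.log (10 / ε) + m) < m * Real.log 2 :=
      hsub ⟨hε0, by linarith⟩
    have h3 : 0 < Real.log (10 / ε) + m := by
      have : 0 < Real.log (10 / ε) := Real.log_pos (by rw [one_lt_div hε0]; linarith)
      linarith
    have h4 : 2 * ε / ((1 - δ) ^ 2 * m) ≤ m / (Real.log (10 / ε) + m) * Real.log 2 := by
      rw [div_mul_eq_mul_div, le_div_iff₀ h3, mul_div_right_comm]
      exact h2.le
    linarith

/-- The supremum is approached as `ε → 0` with `x` fixed: the weight `m / (log (1/ε) + m)` tends to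
zero and the bound of `le_greenTwo` tends to `greenOne δ x`. -/
theorem greenOne_le_upperEnvelope {δ x : ℝ} (hδ : 0 < δ) (hδ1 : δ < 1) (hx : -1 < x)
    (hx1 : x ≤ -1 + δ) : (greenOne δ x : EReal) ≤ upperEnvelope δ x := by
  set m := Real.arcosh ((3 + 2 * δ) / (1 - δ)) with hm
  have h1 : Tendsto (fun ε : ℝ => greenOne δ x -
      m / (Real.log (1 / ε) + m) * (greenOne δ x + Real.log (8 / (x + 1)))) (𝓝[>] 0)
      (𝓝 (greenOne δ x)) := by
    have h2 : Tendsto (fun ε : ℝ => Real.log (1 / ε) + m) (𝓝[>] 0) atTop := by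
      refine tendsto_atTop_add_const_right _ m (Real.tendsto_log_atTop.comp ?_)
      exact tendsto_inv_nhdsGT_zero.congr fun ε => (one_div ε).symm
    simpa using ((h2.const_div_atTop m).mul_const
      (greenOne δ x + Real.log (8 / (x + 1)))).const_sub (greenOne δ x)
  refine le_of_tendsto ((continuous_coe_real_ereal.tendsto _).comp h1) ?_
  filter_upwards [Ioo_mem_nhdsGT (lt_min (sub_pos.2 hδ1) (by linarith : 0 < x + 1))] with ε hε
  have hε1 : ε ≤ 1 - δ := hε.2.le.trans (min_le_left _ _)
  have hε2 : ε < x + 1 := hε.2.trans_le (min_le_right _ _)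
  have h3 := le_greenTwo hδ hδ1 hε.1 hε1 hm (x := x) (by linarith) hx1
  refine (EReal.coe_le_coe_iff.2 h3).trans ?_
  exact le_iSup₂ (f := fun α (_ : α ∈ Ioc (δ - 1) 0) => (greenTwo α δ x : EReal)) (δ - 1 + ε)
    ⟨by linarith [hε.1], by linarith⟩

theorem sq_eq_div_iff {d : ℝ} (hd : 0 < d) :
    d ^ 2 = (1 - d) / (1 + d) ↔ d ^ 3 + d ^ 2 + d = 1 := by
  rw [eq_div_iff (by linarith)]
  constructor <;> intro h <;> linarith

theorem mainTheorem7 :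
    ∃ δs : ℝ,
      -- the critical value is the unique solution of its equation in `(0, 1)`
      (δs ∈ Ioo (0 : ℝ) 1 ∧ δs ^ 2 = (1 - δs) / (1 + δs)) ∧
      (∀ d ∈ Ioo (0 : ℝ) 1, d ^ 2 = (1 - d) / (1 + d) → d = δs) ∧
      (0.543689 ≤ δs ∧ δs < 0.543690) ∧
      -- below the critical value the two functions are not identical
      (∀ δ : ℝ, 0 < δ → δ < δs →
        ∃ x ∈ Ioc (-1 : ℝ) 0, upperEnvelope δ x ≠ (greenOne δ x : EReal)) ∧
      -- near the left end point the two functions always coincide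
      (∀ δ : ℝ, 0 < δ → δ < 1 →
        ∃ xs : ℝ, -1 < xs ∧
          (∀ x ∈ Ioo (-1 : ℝ) xs, upperEnvelope δ x = (greenOne δ x : EReal)) ∧
          Tendsto (fun x => upperEnvelope δ x) (𝓝[>] (-1 : ℝ)) (𝓝 (greenOne δ (-1) : EReal))) := by
  have hmono : ∀ a b : ℝ, 0 < a → a < b → a ^ 3 + a ^ 2 + a < b ^ 3 + b ^ 2 + b := by
    intro a b ha hab
    gcongr
  -- Cleared of denominators, the equation is `d ^ 3 + d ^ 2 + d = 1`, whose left side is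
  -- increasing; a sign change brackets the root to six digits.
  obtain ⟨δs, hδs, hroot⟩ : (1 : ℝ) ∈ (fun d : ℝ => d ^ 3 + d ^ 2 + d) '' Ioo 0.543689 0.543690 :=
    intermediate_value_Ioo (by norm_num) (by fun_prop) ⟨by norm_num, by norm_num⟩
  have h0 : 0 < δs := lt_trans (by norm_num) hδs.1
  have h1 : δs < 1 := hδs.2.trans (by norm_num)
  refine ⟨δs, ⟨⟨h0, h1⟩, (sq_eq_div_iff h0).2 hroot⟩, fun d hd hdeq => ?_,
    ⟨hδs.1.le, hδs.2⟩, fun δ hδ hδs' => ?_, fun δ hδ hδ1 => ?_⟩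
  · have hd' := (sq_eq_div_iff hd.1).1 hdeq
    rcases lt_trichotomy d δs with h | h | h
    · linarith [hmono d δs hd.1 h]
    · exact h
    · linarith [hmono δs d h0 h]
  · have hδ1 := hδs'.trans h1
    refine ⟨0, ⟨by norm_num, le_rfl⟩, ne_of_gt ?_⟩
    have hlt := greenOne_zero_lt_greenTwo_zero hδ hδ1 (by linarith [hmono δ δs hδ hδs'])
    refine (EReal.coe_lt_coe_iff.2 hlt).trans_le ?_
    exact le_iSup₂ (f := fun α (_ : α ∈ Ioc (δ - 1) 0) => (greenTwo α δ 0 : EReal)) 0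
      ⟨by linarith, le_rfl⟩
  · obtain ⟨η, hη, hle⟩ := exists_upperEnvelope_le_greenOne hδ hδ1
    have hηδ := lt_min hη hδ
    have heq : ∀ x ∈ Ioo (-1) (-1 + min η δ), upperEnvelope δ x = (greenOne δ x : EReal) :=
      fun x hx => le_antisymm
        (hle x ⟨hx.1, hx.2.trans_le (by linarith [min_le_left η δ])⟩)
        (greenOne_le_upperEnvelope hδ hδ1 hx.1 (hx.2.le.trans (by linarith [min_le_right η δ])))
    refine ⟨-1 + min η δ, by linarith, heq, ?_⟩
    have hcont : Continuous fun x : ℝ => (greenOne δ x : EReal) := by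
      have h2 : Continuous fun x : ℝ => intervalGreen (-1 + 2 * δ) 1 x :=
        (continuous_intervalGreen (by linarith)).comp Complex.continuous_ofReal
      have h3 : greenOne δ = fun x : ℝ => intervalGreen (-1 + 2 * δ) 1 x :=
        funext (greenOne_eq hδ1)
      rw [h3]
      exact continuous_coe_real_ereal.comp h2
    refine ((hcont.tendsto (-1)).mono_left nhdsWithin_le_nhds).congr' ?_
    filter_upwards [Ioo_mem_nhdsGT (by linarith : (-1 : ℝ) < -1 + min η δ)] with x hx
    exact (heq x hx).symm
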